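/- Let $f_1,\dots,f_N$ be contracting similitudes of $\mathbb{R}^n$ with similarity ratios $r_i\in(0,1)$, let $r_{\min}=\min_i r_i$, $r_{\max}=\max_i r_i$, and let $s$ be the similarity dimension, $\sum_i r_i^s=1$. Let $E=\bigcup_i f_i(E)$ be a compact set with diameter $|E|=1$ and assume the strong separation condition $f_i(E)\cap f_j(E)=\emptyset$ for $i\ne j$. For a word $u=u_1\cdots u_k$ put $f_u=f_{u_1}\circ\cdots\circ f_{u_k}$ and $r_u=r_{u_1}\cdots r_{u_k}$. Let $\mu$ be the natural probability measure on $E$, i.e. $\mu(f_u(E))=r_u^s$ for every word $u$, and let $P^s$ be the $s$-dimensional packing measure, i.e. $P^s(A)=\inf\{\sum_i P^s_0(U_i): A\subset\bigcup_{i\in\mathbb N}U_i\}$ with $P^s_0(U)=\lim_{\delta\to0}\sup\sum_i|B_i|^s$, the supremum over all countable families of pairwise disjoint closed balls $B_i$ with centres in $U$ and diameters $|B_i|\le\delta$. Let $A_1$ be the set of the fixed points of $f_1,\dots,f_N$ and $A_{k+1}=\bigcup_i f_i(A_k)$. Every point of $A_k$ can be written in exactly one way as $x_u:=f_u(y)$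 with a word $u$ of length $k$ and $y$ the fixed point of $f_{u_k}$. Let $\mu_k=\sum_{|u|=k} r_u^s\,\delta_{x_u}$, let $c_k=\min\{|x_u-x_v| : |u|=|v|=k,\ u_1\neq v_1\}$, $\tilde c_k=c_k-2r_{\max}^k$, and let $\tilde c=\tilde c_{\tilde k}$ for some fixed $\tilde k\ge1$ with $\tilde c_{\tilde k}>0$. For $x\in A_k$ let $D_k^x$ be the set of the distances $d=|x-y|$ with $y\in A_k$ and $d\in[\tilde c,\tilde c/r_{\min}]$, and let $D_k=\bigcup_{x\in A_k}D_k^x$. With $B'(x,d)$ the open and $B(x,d)$ the closed ball, put $h_k(x,d)=(2d)^s/\mu_k(B'(x,d))$ and $$\tilde m_k=\max\{h_k(x,d):(x,d)\in A_k\times D_k\}.$$ Then $D_k\ne\emptyset$ (so $\tilde m_k$ is defined) for all large $k$, $P^s(E)<\infty$, and $\tilde m_k\to P^s(E)$ as $k\to\infty$. Moreover, whenever $k\ge1$ and $(\tilde x_k,\tilde d_k)\in A_k\times D_k$ satisfies $h_k(\tilde x_k,\tilde d_k)=\tilde m_k$ and $\mu_k(B'(\tilde x_k,\tilde d_k))=\mu(B(\tilde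 x_k,\tilde d_k))$, we have $\tilde m_k\le P^s(E)$. All of this also holds if the maximum is taken only over the pairs $(x,d)$ with $x\in A_k$ and $d\in D_k^x$. -/

import Mathlib

open MeasureTheory Filter Topology
open scoped ENNReal NNReal

noncomputable section

/-- A finite system of contracting similitudes `f 0, …, f (N - 1)` of `ℝⁿ` with similarity
ratios `r i ∈ (0, 1)`. -/
structure SimilitudeSystem (n N : ℕ) where
  f : Fin N → EuclideanSpace ℝ (Fin n) → EuclideanSpace ℝ (Fin n)
  r : Fin N → ℝ
  r_pos : ∀ i, 0 < r i
  r_lt_one : ∀ i, r i < 1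
  dist_eq : ∀ i x y, dist (f i x) (f i y) = r i * dist x y

/-! ### The packing measure -/

/-- `P^s_δ(A)`: the supremum of `∑ |B_i|^s` over all countable families of pairwise disjoint closed
balls with centres in `A` and diameters at most `δ`. A family is given by its set of pairs
(centre, radius); the ball with radius `d` has diameter `2 * d`. -/
def packingDelta {n : ℕ} (s δ : ℝ) (A : Set (EuclideanSpace ℝ (Fin n))) : ℝ≥0∞ :=
  ⨆ (C : Set (EuclideanSpace ℝ (Fin n) × ℝ)) (_ : C.Countable)
    (_ : ∀ p ∈ C, p.1 ∈ A ∧ 0 < p.2 ∧ 2 * p.2 ≤ δ)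
    (_ : C.PairwiseDisjoint fun p => Metric.closedBall p.1 p.2),
    ∑' p : C, ENNReal.ofReal ((2 * (p : EuclideanSpace ℝ (Fin n) × ℝ).2) ^ s)

/-- The packing premeasure `P^s_0(A) = lim_{δ → 0} P^s_δ(A)`; as `P^s_δ(A)` is monotone in `δ`, the
limit is the infimum. -/
def packingPremeasure {n : ℕ} (s : ℝ) (A : Set (EuclideanSpace ℝ (Fin n))) : ℝ≥0∞ :=
  ⨅ (δ : ℝ) (_ : 0 < δ), packingDelta s δ A

/-- The packing measure `P^s(A)`: the infimum of `∑ P^s_0(U_i)` over all countable covers of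
`A`. -/
def packingMeasure {n : ℕ} (s : ℝ) (A : Set (EuclideanSpace ℝ (Fin n))) : ℝ≥0∞ :=
  ⨅ (U : ℕ → Set (EuclideanSpace ℝ (Fin n))) (_ : A ⊆ ⋃ i, U i), ∑' i, packingPremeasure s (U i)

namespace SimilitudeSystem

variable {n N : ℕ}

lemma contractingWith (S : SimilitudeSystem n N) (i : Fin N) :
    ContractingWith (S.r i).toNNReal (S.f i) := by
  refine ⟨?_, LipschitzWith.of_dist_le_mul fun x y => ?_⟩
  · rw [← NNReal.coe_lt_coe, Real.coe_toNNReal _ (S.r_pos i).le]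
    exact S.r_lt_one i
  · rw [Real.coe_toNNReal _ (S.r_pos i).le, S.dist_eq]

def rMin (S : SimilitudeSystem n N) : ℝ := ⨅ i, S.r i

def rMax (S : SimilitudeSystem n N) : ℝ := ⨆ i, S.r i

/-! ### Words -/

/-- `f_u = f_{u 0} ∘ f_{u 1} ∘ ⋯ ∘ f_{u (k - 1)}` for a word `u` of length `k`. -/
def wordMap (S : SimilitudeSystem n N) :
    (k : ℕ) → (Fin k → Fin N) → EuclideanSpace ℝ (Fin n) → EuclideanSpace ℝ (Fin n)
  | 0, _ => id
  | k + 1, u => S.f (u 0) ∘ S.wordMap k (fun j => u j.succ)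

/-- `r_u = r_{u 0} r_{u 1} ⋯ r_{u (k - 1)}`. -/
def wordRatio (S : SimilitudeSystem n N) {k : ℕ} (u : Fin k → Fin N) : ℝ := ∏ j, S.r (u j)

/-! ### The natural probability measure on a self-similar set `E` -/

/-- The projection `π` from codes to points: `π(ω)` is the point of `⋂ k, f_{ω 0 ⋯ ω (k - 1)}(E)`
(a single point if `E` is a nonempty compact set with `E = ⋃ i, f i '' E`). -/
def coding (S : SimilitudeSystem n N) (E : Set (EuclideanSpace ℝ (Fin n))) (ω : ℕ → Fin N) :
    EuclideanSpace ℝ (Fin n) :=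
  Classical.epsilon fun x => ∀ k : ℕ, x ∈ S.wordMap k (fun j => ω j) '' E

/-- The measure on the alphabet that gives the letter `i` the mass `r i ^ s`. -/
def letterMeasure (S : SimilitudeSystem n N) (s : ℝ) : Measure (Fin N) :=
  ∑ i, ENNReal.ofReal (S.r i ^ s) • Measure.dirac i

/-- The natural probability measure `μ`, with `μ (f_u(E)) = r_u ^ s` for every word `u`: the image
under the projection `π` of the product measure on the code space `(Fin N) ^ ℕ`. -/
def naturalMeasure (S : SimilitudeSystem n N) (s : ℝ) (E : Set (EuclideanSpace ℝ (Fin n))) :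
    Measure (EuclideanSpace ℝ (Fin n)) :=
  (Measure.infinitePi fun _ : ℕ => S.letterMeasure s).map (S.coding E)

/-! ### The algorithm -/

/-- The fixed point of `f i`. -/
def fixedPt (S : SimilitudeSystem n N) (i : Fin N) : EuclideanSpace ℝ (Fin n) :=
  ContractingWith.fixedPoint (S.f i) (S.contractingWith i)

/-- `A_1` is the set of the fixed points, and `A_k = ⋃ i, f_i(A_{k-1})` for `k ≥ 2`. The value at
`k = 0` is not used. -/
def iterates (S : SimilitudeSystem n N) : ℕ → Set (EuclideanSpace ℝ (Fin n))
  | 0 => ∅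
  | 1 => Set.range S.fixedPt
  | k + 2 => ⋃ i, S.f i '' S.iterates (k + 1)

/-- The point of `A_k` with the address `u = u_1 ⋯ u_k` (`k ≥ 1`), that is, the image under `f_u`
of the fixed point of `f_{u_k}`. The value at `k = 0` is not used. -/
def wordPt (S : SimilitudeSystem n N) : (k : ℕ) → (Fin k → Fin N) → EuclideanSpace ℝ (Fin n)
  | 0, _ => 0
  | k + 1, u => S.wordMap (k + 1) u (S.fixedPt (u (Fin.last k)))

lemma f_fixedPt (S : SimilitudeSystem n N) (i : Fin N) : S.f i (S.fixedPt i) = S.fixedPt i :=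
  (S.contractingWith i).fixedPoint_isFixedPt

/-- `A_k` consists of the points with an address of length `k`. -/
lemma iterates_eq_range_wordPt (S : SimilitudeSystem n N) (k : ℕ) :
    S.iterates (k + 1) = Set.range (S.wordPt (k + 1)) := by
  induction k with
  | zero =>
    ext x
    constructor
    · rintro ⟨i, rfl⟩
      exact ⟨fun _ => i, by simp [wordPt, wordMap, f_fixedPt]⟩
    · rintro ⟨u, rfl⟩
      exact ⟨u 0, by simp [wordPt, wordMap, f_fixedPt]⟩
  | succ k ih =>
    ext x
    simp only [iterates, ih, Set.mem_iUnion, Set.mem_image, Set.mem_range, exists_exists_eq_and]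
    constructor
    · rintro ⟨i, u, rfl⟩
      exact ⟨Fin.cons i u, by simp [wordPt, wordMap, ← Fin.succ_last]⟩
    · rintro ⟨u, rfl⟩
      exact ⟨u 0, fun j => u j.succ, by simp [wordPt, wordMap]⟩

/-- `c_k` (`k ≥ 1`): the least distance between points of `A_k` whose addresses have different
first letters. The value at `k = 0` is not used. -/
def cStage (S : SimilitudeSystem n N) : ℕ → ℝ
  | 0 => 0
  | k + 1 => sInf {d | ∃ u v : Fin (k + 1) → Fin N, u 0 ≠ v 0 ∧
      d = dist (S.wordPt (k + 1) u) (S.wordPt (k + 1) v)}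

/-- `c̃_k = c_k - 2 r_max ^ k`. -/
def cTilde (S : SimilitudeSystem n N) (k : ℕ) : ℝ := S.cStage k - 2 * S.rMax ^ k

/-- The discrete measure `μ_k` (`k ≥ 1`), which gives the mass `r_u ^ s` to the point of `A_k` with
the address `u`. -/
def discreteMeasure (S : SimilitudeSystem n N) (s : ℝ) (k : ℕ) :
    Measure (EuclideanSpace ℝ (Fin n)) :=
  ∑ u : Fin k → Fin N, ENNReal.ofReal (S.wordRatio u ^ s) • Measure.dirac (S.wordPt k u)

/-- The discrete density `h_k(x, d) = (2 d) ^ s / μ_k (B'(x, d))` with the open ball `B'(x, d)`. -/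
def discreteDensity (S : SimilitudeSystem n N) (s : ℝ) (k : ℕ)
    (p : EuclideanSpace ℝ (Fin n) × ℝ) : ℝ :=
  (2 * p.2) ^ s / (S.discreteMeasure s k).real (Metric.ball p.1 p.2)

/-- `D_k^x`: the distances from `x` to points of `A_k` that lie in `[c̃, c̃ / r_min]`. -/
def radiiAt (S : SimilitudeSystem n N) (c : ℝ) (k : ℕ) (x : EuclideanSpace ℝ (Fin n)) : Set ℝ :=
  {d | (∃ y ∈ S.iterates k, d = dist x y) ∧ d ∈ Set.Icc c (c / S.rMin)}

/-- `D_k`: the union of the sets `D_k^x`, `x ∈ A_k`. -/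
def radii (S : SimilitudeSystem n N) (c : ℝ) (k : ℕ) : Set ℝ :=
  ⋃ x ∈ S.iterates k, S.radiiAt c k x

/-- All pairs `(x, d) ∈ A_k × D_k`. -/
def allPairs (S : SimilitudeSystem n N) (c : ℝ) (k : ℕ) : Set (EuclideanSpace ℝ (Fin n) × ℝ) :=
  S.iterates k ×ˢ S.radii c k

/-- The pairs `(x, d)` with `x ∈ A_k` and `d ∈ D_k^x`. -/
def ownPairs (S : SimilitudeSystem n N) (c : ℝ) (k : ℕ) : Set (EuclideanSpace ℝ (Fin n) × ℝ) :=
  {p | p.1 ∈ S.iterates k ∧ p.2 ∈ S.radiiAt c k p.1}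

/-- The largest value of `h_k` on a (finite, nonempty) set `Q` of pairs `(x, d)`. -/
def maxDensity (S : SimilitudeSystem n N) (s : ℝ) (k : ℕ)
    (Q : Set (EuclideanSpace ℝ (Fin n) × ℝ)) : ℝ :=
  sSup (S.discreteDensity s k '' Q)

end SimilitudeSystem

end

/-!
The theorem rests on a density formula for the packing measure: with `c = c̃` and `μ` the natural
measure, `P^s(E)` is the supremum of `(2 d) ^ s / μ(B(x, d))` over `x ∈ E` and
`0 < d ≤ c / r_min`.

* `c` is a lower bound for the distances of the pieces `f i '' E`
  (`IsAttractor.cTilde_le_dist`). So a ball of radius less than `c` with centre in `f i '' E` meets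
  no other piece, and the density is invariant under blowing it up by the inverse of `f i`
  (`IsSelfSimilarMeasure.measure_closedBall_f`). This brings every small ball to a radius in
  `[c, c / r_min)`.
* A packing with small balls of centres in `E` consists of disjoint balls with
  `|B| ^ s ≤ K μ(B)` if `K` bounds the densities, so `P^s(E) ≤ K`
  (`packingMeasure_le_of_forall_le`).
* Conversely, almost every code contains every finite word at arbitrarily late places
  (`IsSelfSimilarMeasure.ae_exists_wordMap`). So small copies of a given ball are centred at almost
  every point of `E`, and the Besicovitch covering theorem packs almost all of `E ∩ U` with them,
  for every set `U` of a cover of `E` (`le_packingMeasure_of_forall_exists`). The result is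
  `(2 d) ^ s ≤ P^s(E) μ(B(x, d))` (`IsSelfSimilarMeasure.rpow_le_packingMeasure_mul`).

With `η = r_max ^ k`, the discrete measures satisfy `μ_k(B'(x, t)) ≤ μ(B(x, t + η))` and
`μ(B(x, d - 2 η)) ≤ μ_k(B'(x, d))`. The second inequality bounds all values of `h_k`
asymptotically by `P^s(E)` (`IsSelfSimilarMeasure.eventually_forall_rpow_le`). For the lower bound
(`IsSelfSimilarMeasure.eventually_exists_le_rpow`), let `B(x, t)` be a ball of density almost
`P^s(E)` with `x` in some `A_k`; the sets `A_k` increase. Enlarging the open ball until its boundary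
meets `A_k` keeps its measure `μ_k` and raises its density, so the new radius can be taken in
`D_k^x` unless it exceeds `c / r_min`. In that case `B'(x, c / r_min)` already has almost the
density `P^s(E)`, and so has its image of radius `c` under the map with the ratio `r_min`. If that
ball could also be enlarged to the radius `c / r_min` without meeting `A_k`, its density would grow
by the factor `r_min ^ (-s) > 1`, against the upper bound.

The last claim is the density bound for `μ` itself.
-/

/-! ### Packing measures and densities -/

section Packing

variable {n : ℕ} {s : ℝ} {E : Set (EuclideanSpace ℝ (Fin n))}
  {μ : Measure (EuclideanSpace ℝ (Fin n))} {κ : ℝ≥0∞}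

lemma packingPremeasure_empty (s : ℝ) :
    packingPremeasure s (∅ : Set (EuclideanSpace ℝ (Fin n))) = 0 := by
  refine nonpos_iff_eq_zero.1 ((iInf₂_le 1 one_pos).trans ?_)
  refine iSup_le fun C => iSup_le fun _ => iSup_le fun hC => iSup_le fun _ => ?_
  have : C = ∅ := Set.eq_empty_iff_forall_notMem.2 fun p hp => (hC p hp).1
  subst this
  simp

/-- If the balls with small radii and centres in `E` satisfy `|B| ^ s ≤ κ μ(B)`, then
`P^s(E) ≤ κ μ(ℝⁿ)`: the balls of a packing are disjoint. -/
lemma packingMeasure_le_of_forall_le {δ : ℝ} (hδ : 0 < δ)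
    (hκ : ∀ x ∈ E, ∀ d, 0 < d → 2 * d ≤ δ →
      ENNReal.ofReal ((2 * d) ^ s) ≤ κ * μ (Metric.closedBall x d)) :
    packingMeasure s E ≤ κ * μ Set.univ := by
  have hpre : packingPremeasure s E ≤ κ * μ Set.univ := by
    refine (iInf₂_le δ hδ).trans ?_
    refine iSup_le fun C => iSup_le fun hcount => iSup_le fun hC => iSup_le fun hdisj => ?_
    calc ∑' p : C, ENNReal.ofReal ((2 * (p : EuclideanSpace ℝ (Fin n) × ℝ).2) ^ s)
        ≤ ∑' p : C, κ * μ (Metric.closedBall p.1.1 p.1.2) :=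
          ENNReal.tsum_le_tsum fun p =>
            hκ _ (hC p p.2).1 _ (hC p p.2).2.1 (hC p p.2).2.2
      _ = κ * μ (⋃ p ∈ C, Metric.closedBall p.1 p.2) := by
          rw [ENNReal.tsum_mul_left,
            measure_biUnion hcount hdisj fun _ _ => measurableSet_closedBall]
      _ ≤ κ * μ Set.univ := by gcongr; exact Set.subset_univ _
  refine (iInf₂_le (fun i => if i = 0 then E else ∅) fun x hx =>
    Set.mem_iUnion.2 ⟨0, by simpa using hx⟩).trans ?_
  rw [tsum_eq_single 0 fun i hi => by simp [hi, packingPremeasure_empty]]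
  simpa using hpre

/-- If every point of `A` is the centre of arbitrarily small balls with `κ μ(B) ≤ |B| ^ s`, then
`κ μ(A) ≤ P^s(A)`: by the Besicovitch covering theorem such balls pack `μ`-almost all of the
intersection of `A` with any set. -/
lemma le_packingMeasure_of_forall_exists [IsFiniteMeasure μ]
    {A : Set (EuclideanSpace ℝ (Fin n))} (hAE : A ⊆ E)
    (hA : ∀ y ∈ A, ∀ δ > 0, ∃ ρ, 0 < ρ ∧ ρ < δ ∧
      κ * μ (Metric.closedBall y ρ) ≤ ENNReal.ofReal ((2 * ρ) ^ s)) :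
    κ * μ A ≤ packingMeasure s E := by
  have key : ∀ U, κ * μ (A ∩ U) ≤ packingPremeasure s U := by
    refine fun U => le_iInf₂ fun δ hδ => ?_
    obtain ⟨t, r, ht, htA, hr, h0, hdisj⟩ := Besicovitch.exists_disjoint_closedBall_covering_ae μ
      (fun y => {ρ | κ * μ (Metric.closedBall y ρ) ≤ ENNReal.ofReal ((2 * ρ) ^ s)}) (A ∩ U)
      (fun y hy ε hε => by
        obtain ⟨ρ, h1, h2, h3⟩ := hA y hy.1 ε hε
        exact ⟨ρ, h3, h1, h2⟩) (fun _ => δ / 2) (fun _ _ => half_pos hδ)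
    have hinj : Function.Injective fun x => (x, r x) := fun x y hxy => (Prod.ext_iff.1 hxy).1
    calc κ * μ (A ∩ U) ≤ κ * μ (⋃ x ∈ t, Metric.closedBall x (r x)) := by
          gcongr κ * ?_
          exact measure_mono_ae (ae_le_set.2 h0)
      _ = ∑' x : t, κ * μ (Metric.closedBall x.1 (r x)) := by
          rw [measure_biUnion ht hdisj fun _ _ => measurableSet_closedBall,
            ENNReal.tsum_mul_left]
      _ ≤ ∑' x : t, ENNReal.ofReal ((2 * r x) ^ s) :=
          ENNReal.tsum_le_tsum fun x => (hr x x.2).1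
      _ = ∑' p : (fun x => (x, r x)) '' t,
            ENNReal.ofReal ((2 * (p : EuclideanSpace ℝ (Fin n) × ℝ).2) ^ s) :=
          (tsum_image (fun p : EuclideanSpace ℝ (Fin n) × ℝ => ENNReal.ofReal ((2 * p.2) ^ s))
            hinj.injOn).symm
      _ ≤ packingDelta s δ U := by
          refine le_iSup_of_le ((fun x => (x, r x)) '' t) (le_iSup_of_le (ht.image _)
            (le_iSup_of_le ?_ (le_iSup_of_le ?_ le_rfl)))
          · rintro _ ⟨x, hx, rfl⟩
            have h1 := (hr x hx).2
            exact ⟨(htA hx).2, h1.1, by linarith [h1.2]⟩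
          · exact (hinj.injOn.pairwiseDisjoint_image).2 hdisj
  refine le_iInf₂ fun U hU => ?_
  calc κ * μ A ≤ κ * μ (⋃ i, A ∩ U i) := by
        gcongr
        rw [← Set.inter_iUnion]
        exact fun x hx => ⟨hx, hU (hAE hx)⟩
    _ ≤ κ * ∑' i, μ (A ∩ U i) := by gcongr; exact measure_iUnion_le _
    _ = ∑' i, κ * μ (A ∩ U i) := ENNReal.tsum_mul_left.symm
    _ ≤ ∑' i, packingPremeasure s (U i) := ENNReal.tsum_le_tsum fun i => key _

end Packing

namespace SimilitudeSystem

variable {n N : ℕ}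

/-! ### Words and self-similar sets -/

lemma continuous_f (S : SimilitudeSystem n N) (i : Fin N) : Continuous (S.f i) :=
  (S.contractingWith i).toLipschitzWith.continuous

lemma measurable_f (S : SimilitudeSystem n N) (i : Fin N) : Measurable (S.f i) :=
  (S.continuous_f i).measurable

lemma rMin_le (S : SimilitudeSystem n N) (i : Fin N) : S.rMin ≤ S.r i :=
  ciInf_le (Set.finite_range S.r).bddBelow i

lemma le_rMax (S : SimilitudeSystem n N) (i : Fin N) : S.r i ≤ S.rMax :=
  le_ciSup (Set.finite_range S.r).bddAbove i

lemma exists_eq_rMin (S : SimilitudeSystem n N) [Nonempty (Fin N)] : ∃ i, S.r i = S.rMin :=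
  exists_eq_ciInf_of_finite

lemma exists_eq_rMax (S : SimilitudeSystem n N) [Nonempty (Fin N)] : ∃ i, S.r i = S.rMax :=
  exists_eq_ciSup_of_finite

lemma rMin_pos (S : SimilitudeSystem n N) [Nonempty (Fin N)] : 0 < S.rMin := by
  obtain ⟨i, hi⟩ := S.exists_eq_rMin
  exact hi ▸ S.r_pos i

lemma rMin_lt_one (S : SimilitudeSystem n N) [Nonempty (Fin N)] : S.rMin < 1 := by
  obtain ⟨i, hi⟩ := S.exists_eq_rMin
  exact hi ▸ S.r_lt_one i

lemma rMax_pos (S : SimilitudeSystem n N) [Nonempty (Fin N)] : 0 < S.rMax := by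
  obtain ⟨i, hi⟩ := S.exists_eq_rMax
  exact hi ▸ S.r_pos i

lemma rMax_lt_one (S : SimilitudeSystem n N) [Nonempty (Fin N)] : S.rMax < 1 := by
  obtain ⟨i, hi⟩ := S.exists_eq_rMax
  exact hi ▸ S.r_lt_one i

lemma tendsto_rMax_pow (S : SimilitudeSystem n N) [Nonempty (Fin N)] :
    Tendsto (fun k : ℕ => S.rMax ^ k) atTop (𝓝 0) :=
  tendsto_pow_atTop_nhds_zero_of_lt_one S.rMax_pos.le S.rMax_lt_one

lemma ratio_rpow_pos (S : SimilitudeSystem n N) (s : ℝ) (i : Fin N) : 0 < S.r i ^ s :=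
  Real.rpow_pos_of_pos (S.r_pos i) s

lemma wordRatio_pos (S : SimilitudeSystem n N) {k : ℕ} (u : Fin k → Fin N) :
    0 < S.wordRatio u :=
  Finset.prod_pos fun _ _ => S.r_pos _

lemma wordRatio_le (S : SimilitudeSystem n N) {k : ℕ} (u : Fin k → Fin N) :
    S.wordRatio u ≤ S.rMax ^ k := by
  have h := Finset.prod_le_prod (s := Finset.univ) (f := fun j => S.r (u j))
    (g := fun _ : Fin k => S.rMax) (fun _ _ => (S.r_pos _).le) (fun _ _ => S.le_rMax _)
  simpa [wordRatio] using h

lemma rMin_pow_le_wordRatio (S : SimilitudeSystem n N) [Nonempty (Fin N)] {k : ℕ}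
    (u : Fin k → Fin N) : S.rMin ^ k ≤ S.wordRatio u := by
  have h := Finset.prod_le_prod (s := Finset.univ) (f := fun _ : Fin k => S.rMin)
    (g := fun j => S.r (u j)) (fun _ _ => S.rMin_pos.le) (fun _ _ => S.rMin_le _)
  simpa [wordRatio] using h

lemma wordRatio_cons (S : SimilitudeSystem n N) {k : ℕ} (i : Fin N) (u : Fin k → Fin N) :
    S.wordRatio (Fin.cons i u : Fin (k + 1) → Fin N) = S.r i * S.wordRatio u := by
  simp [wordRatio, Fin.prod_univ_succ]

lemma wordMap_cons (S : SimilitudeSystem n N) {k : ℕ} (i : Fin N) (u : Fin k → Fin N)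
    (x : EuclideanSpace ℝ (Fin n)) :
    S.wordMap (k + 1) (Fin.cons i u) x = S.f i (S.wordMap k u x) := by
  simp [wordMap]

lemma dist_wordMap (S : SimilitudeSystem n N) {k : ℕ} (u : Fin k → Fin N)
    (x y : EuclideanSpace ℝ (Fin n)) :
    dist (S.wordMap k u x) (S.wordMap k u y) = S.wordRatio u * dist x y := by
  induction k with
  | zero => simp [wordMap, wordRatio]
  | succ k ih =>
    simp only [wordMap, Function.comp, S.dist_eq, ih, wordRatio, Fin.prod_univ_succ]
    ring

lemma continuous_wordMap (S : SimilitudeSystem n N) {k : ℕ} (u : Fin k → Fin N) :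
    Continuous (S.wordMap k u) := by
  induction k with
  | zero => exact continuous_id
  | succ k ih => exact (S.continuous_f _).comp (ih _)

/-- `E` is the self-similar set of the system `S`, normalised to have diameter `1`, and `s` is the
similarity dimension of `S`. -/
structure IsAttractor (S : SimilitudeSystem n N) (s : ℝ)
    (E : Set (EuclideanSpace ℝ (Fin n))) : Prop where
  sum_rpow : ∑ i, S.r i ^ s = 1
  isCompact : IsCompact E
  eq_iUnion : E = ⋃ i, S.f i '' E
  diam_eq : Metric.diam E = 1

namespace IsAttractor

variable {S : SimilitudeSystem n N} {s : ℝ} {E : Set (EuclideanSpace ℝ (Fin n))}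
  {x y : EuclideanSpace ℝ (Fin n)}

lemma nonempty_letters (h : IsAttractor S s E) : Nonempty (Fin N) := by
  by_contra hN
  have := not_nonempty_iff.1 hN
  simpa using h.sum_rpow

lemma nonempty (h : IsAttractor S s E) : E.Nonempty := by
  rw [Set.nonempty_iff_ne_empty]
  intro h0
  simpa [h0] using h.diam_eq

lemma dist_le_one (h : IsAttractor S s E) (hx : x ∈ E) (hy : y ∈ E) : dist x y ≤ 1 :=
  h.diam_eq ▸ Metric.dist_le_diam_of_mem h.isCompact.isBounded hx hy

lemma f_mem (h : IsAttractor S s E) (i : Fin N) (hx : x ∈ E) : S.f i x ∈ E := by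
  rw [h.eq_iUnion]
  exact Set.mem_iUnion.2 ⟨i, x, hx, rfl⟩

lemma exists_f_eq (h : IsAttractor S s E) (hx : x ∈ E) : ∃ i, ∃ y ∈ E, S.f i y = x := by
  rw [h.eq_iUnion] at hx
  exact Set.mem_iUnion.1 hx

lemma wordMap_mem (h : IsAttractor S s E) {k : ℕ} (u : Fin k → Fin N) (hx : x ∈ E) :
    S.wordMap k u x ∈ E := by
  induction k with
  | zero => exact hx
  | succ k ih => exact h.f_mem _ (ih _)

lemma exists_wordMap_eq (h : IsAttractor S s E) (k : ℕ) (hx : x ∈ E) :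
    ∃ u : Fin k → Fin N, ∃ y ∈ E, S.wordMap k u y = x := by
  induction k generalizing x with
  | zero => exact ⟨Fin.elim0, x, hx, rfl⟩
  | succ k ih =>
    obtain ⟨i, y, hy, rfl⟩ := h.exists_f_eq hx
    obtain ⟨u, z, hz, rfl⟩ := ih hy
    exact ⟨Fin.cons i u, z, hz, S.wordMap_cons i u z⟩

lemma dist_wordMap_le (h : IsAttractor S s E) {k : ℕ} (u : Fin k → Fin N) (hx : x ∈ E)
    (hy : y ∈ E) : dist (S.wordMap k u x) (S.wordMap k u y) ≤ S.rMax ^ k := by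
  rw [S.dist_wordMap]
  calc S.wordRatio u * dist x y ≤ S.wordRatio u * 1 :=
        mul_le_mul_of_nonneg_left (h.dist_le_one hx hy) (S.wordRatio_pos u).le
    _ ≤ S.rMax ^ k := by rw [mul_one]; exact S.wordRatio_le u

/-- The similarity dimension is positive: `s ≤ 0` would force `N = 1`, and then `E = f 0 '' E`
would have diameter `0`. -/
lemma dim_pos (h : IsAttractor S s E) : 0 < s := by
  by_contra! hs
  obtain ⟨i⟩ := h.nonempty_letters
  have h1 : ∀ j, 1 ≤ S.r j ^ s := fun j =>
    Real.one_le_rpow_of_pos_of_le_one_of_nonpos (S.r_pos j) (S.r_lt_one j).le hs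
  have hsub : ∀ j, j = i := by
    by_contra! hj
    obtain ⟨j, hj⟩ := hj
    have h2 : S.r j ^ s + S.r i ^ s ≤ ∑ i, S.r i ^ s := by
      rw [← Finset.sum_pair (f := fun i => S.r i ^ s) hj]
      exact Finset.sum_le_sum_of_subset_of_nonneg (Finset.subset_univ _)
        fun k _ _ => zero_le_one.trans (h1 k)
    rw [h.sum_rpow] at h2
    linarith [h1 i, h1 j]
  have h3 : Metric.diam E ≤ S.r i := by
    refine Metric.diam_le_of_forall_dist_le (S.r_pos i).le fun x hx y hy => ?_
    obtain ⟨a, x, hx', rfl⟩ := h.exists_f_eq hx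
    obtain ⟨b, y, hy', rfl⟩ := h.exists_f_eq hy
    rw [hsub a, hsub b, S.dist_eq]
    exact mul_le_of_le_one_right (S.r_pos i).le (h.dist_le_one hx' hy')
  linarith [h.diam_eq, S.r_lt_one i]

/-! ### The sets `A_k` -/

lemma fixedPt_mem (h : IsAttractor S s E) (i : Fin N) : S.fixedPt i ∈ E := by
  obtain ⟨x, hx⟩ := h.nonempty
  refine h.isCompact.isClosed.mem_of_tendsto
    ((S.contractingWith i).tendsto_iterate_fixedPoint x) (Eventually.of_forall fun k => ?_)
  induction k with
  | zero => exact hx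
  | succ k ih =>
    rw [Function.iterate_succ_apply']
    exact h.f_mem i ih

lemma dist_wordPt_le (h : IsAttractor S s E) {k : ℕ} (hk : 1 ≤ k) (u : Fin k → Fin N)
    (hx : x ∈ E) : dist (S.wordMap k u x) (S.wordPt k u) ≤ S.rMax ^ k := by
  obtain ⟨k, rfl⟩ := Nat.exists_eq_add_of_le' hk
  exact h.dist_wordMap_le u hx (h.fixedPt_mem _)

lemma wordPt_mem (h : IsAttractor S s E) {k : ℕ} (hk : 1 ≤ k) (u : Fin k → Fin N) :
    S.wordPt k u ∈ E := by
  obtain ⟨k, rfl⟩ := Nat.exists_eq_add_of_le' hk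
  exact h.wordMap_mem u (h.fixedPt_mem _)

end IsAttractor

lemma wordPt_mem_iterates (S : SimilitudeSystem n N) {k : ℕ} (hk : 1 ≤ k) (u : Fin k → Fin N) :
    S.wordPt k u ∈ S.iterates k := by
  obtain ⟨k, rfl⟩ := Nat.exists_eq_add_of_le' hk
  rw [S.iterates_eq_range_wordPt]
  exact ⟨u, rfl⟩

lemma finite_iterates (S : SimilitudeSystem n N) (k : ℕ) : (S.iterates k).Finite := by
  cases k with
  | zero => exact Set.finite_empty
  | succ k =>
    rw [S.iterates_eq_range_wordPt]
    exact Set.finite_range _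

lemma f_mem_iterates (S : SimilitudeSystem n N) {k : ℕ} (i : Fin N)
    {x : EuclideanSpace ℝ (Fin n)} (hx : x ∈ S.iterates k) :
    S.f i x ∈ S.iterates (k + 1) := by
  cases k with
  | zero => exact hx.elim
  | succ k => exact Set.mem_iUnion.2 ⟨i, x, hx, rfl⟩

/-- The sets `A_k` increase, since the fixed point of `f i` lies in `f i '' A_1`. -/
lemma monotone_iterates (S : SimilitudeSystem n N) : Monotone S.iterates := by
  refine monotone_nat_of_le_succ fun k => ?_
  induction k with
  | zero => exact Set.empty_subset _
  | succ k ih =>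
    cases k with
    | zero =>
      rintro _ ⟨i, rfl⟩
      exact Set.mem_iUnion.2 ⟨i, S.fixedPt i, ⟨i, rfl⟩, S.f_fixedPt i⟩
    | succ k =>
      intro x hx
      obtain ⟨i, y, hy, rfl⟩ := Set.mem_iUnion.1 hx
      exact Set.mem_iUnion.2 ⟨i, y, ih hy, rfl⟩

namespace IsAttractor

variable {S : SimilitudeSystem n N} {s : ℝ} {E : Set (EuclideanSpace ℝ (Fin n))}
  {x y : EuclideanSpace ℝ (Fin n)}

lemma iterates_subset (h : IsAttractor S s E) (k : ℕ) : S.iterates k ⊆ E := by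
  cases k with
  | zero => exact Set.empty_subset _
  | succ k =>
    rw [S.iterates_eq_range_wordPt]
    rintro _ ⟨u, rfl⟩
    exact h.wordPt_mem k.succ_pos u

lemma exists_mem_iterates (h : IsAttractor S s E) {k : ℕ} (hk : 1 ≤ k) (hx : x ∈ E) :
    ∃ y ∈ S.iterates k, dist x y ≤ S.rMax ^ k := by
  obtain ⟨u, z, hz, rfl⟩ := h.exists_wordMap_eq k hx
  exact ⟨_, S.wordPt_mem_iterates hk u, h.dist_wordPt_le hk u hz⟩

/-- `c̃_k` is a lower bound for the distance between two different pieces `f i '' E`. -/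
lemma cTilde_le_dist (h : IsAttractor S s E) {k : ℕ} (hk : 1 ≤ k) {i j : Fin N} (hij : i ≠ j)
    (hx : x ∈ E) (hy : y ∈ E) : S.cTilde k ≤ dist (S.f i x) (S.f j y) := by
  obtain ⟨k, rfl⟩ := Nat.exists_eq_add_of_le' hk
  obtain ⟨u, x, hx', rfl⟩ := h.exists_wordMap_eq k hx
  obtain ⟨v, y, hy', rfl⟩ := h.exists_wordMap_eq k hy
  rw [← S.wordMap_cons, ← S.wordMap_cons]
  have h1 := h.dist_wordPt_le hk (Fin.cons i u) hx'
  have h2 := h.dist_wordPt_le hk (Fin.cons j v) hy'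
  have h3 : S.cStage (k + 1) ≤
      dist (S.wordPt (k + 1) (Fin.cons i u)) (S.wordPt (k + 1) (Fin.cons j v)) := by
    refine csInf_le ⟨0, ?_⟩ ⟨_, _, by simpa using hij, rfl⟩
    rintro _ ⟨u, v, -, rfl⟩
    exact dist_nonneg
  have h4 := dist_triangle4 (S.wordPt (k + 1) (Fin.cons i u)) (S.wordMap (k + 1) (Fin.cons i u) x)
    (S.wordMap (k + 1) (Fin.cons j v) y) (S.wordPt (k + 1) (Fin.cons j v))
  rw [dist_comm (S.wordPt (k + 1) (Fin.cons i u)) (S.wordMap _ _ _)] at h4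
  simp only [cTilde]
  linarith

end IsAttractor

/-! ### The coding map -/

lemma wordMap_succ_last (S : SimilitudeSystem n N) (k : ℕ) (ω : ℕ → Fin N)
    (x : EuclideanSpace ℝ (Fin n)) :
    S.wordMap (k + 1) (fun j => ω j) x = S.wordMap k (fun j => ω j) (S.f (ω k) x) := by
  induction k generalizing ω with
  | zero => simp [wordMap]
  | succ k ih =>
    have h := ih (fun j => ω (j + 1))
    simp only [wordMap, Function.comp, Fin.val_succ, Fin.val_zero] at h ⊢
    rw [h]

/-- The code `i ω 0 ω 1 ⋯` obtained by putting the letter `i` in front of `ω`. -/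
def consCode (i : Fin N) (ω : ℕ → Fin N) : ℕ → Fin N
  | 0 => i
  | j + 1 => ω j

lemma measurable_consCode (i : Fin N) : Measurable (consCode i) := by
  refine measurable_pi_iff.2 fun j => ?_
  cases j with
  | zero => exact measurable_const
  | succ j => exact measurable_pi_apply j

namespace IsAttractor

variable {S : SimilitudeSystem n N} {s : ℝ} {E : Set (EuclideanSpace ℝ (Fin n))}
  {x y : EuclideanSpace ℝ (Fin n)}

lemma coding_mem (h : IsAttractor S s E) (ω : ℕ → Fin N) (k : ℕ) :
    S.coding E ω ∈ S.wordMap k (fun j => ω j) '' E := by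
  have hc : ∀ k, IsCompact (S.wordMap k (fun j => ω j) '' E) := fun k =>
    h.isCompact.image (S.continuous_wordMap _)
  have hne : (⋂ k, S.wordMap k (fun j => ω j) '' E).Nonempty := by
    refine IsCompact.nonempty_iInter_of_sequence_nonempty_isCompact_isClosed _ (fun k => ?_)
      (fun k => h.nonempty.image _) (hc 0) fun k => (hc k).isClosed
    rintro _ ⟨x, hx, rfl⟩
    exact ⟨S.f (ω k) x, h.f_mem _ hx, (S.wordMap_succ_last k ω x).symm⟩
  obtain ⟨x, hx⟩ := hne
  exact Classical.epsilon_spec (p := fun x => ∀ k : ℕ, x ∈ S.wordMap k (fun j => ω j) '' E)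
    ⟨x, Set.mem_iInter.1 hx⟩ k

lemma coding_mem_self (h : IsAttractor S s E) (ω : ℕ → Fin N) : S.coding E ω ∈ E := by
  obtain ⟨x, hx, he⟩ := h.coding_mem ω 0
  exact he ▸ hx

lemma eq_coding (h : IsAttractor S s E) (ω : ℕ → Fin N)
    (hx : ∀ k : ℕ, x ∈ S.wordMap k (fun j => ω j) '' E) : x = S.coding E ω := by
  have := h.nonempty_letters
  refine dist_le_zero.1 (ge_of_tendsto' S.tendsto_rMax_pow fun k => ?_)
  obtain ⟨a, ha, he⟩ := hx k
  obtain ⟨b, hb, hf⟩ := h.coding_mem ω k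
  rw [← he, ← hf]
  exact h.dist_wordMap_le _ ha hb

lemma coding_consCode (h : IsAttractor S s E) (i : Fin N) (ω : ℕ → Fin N) :
    S.coding E (consCode i ω) = S.f i (S.coding E ω) := by
  refine (h.eq_coding _ fun k => ?_).symm
  cases k with
  | zero => exact ⟨_, h.f_mem i (h.coding_mem_self ω), rfl⟩
  | succ k =>
    obtain ⟨x, hx, he⟩ := h.coding_mem ω k
    exact ⟨x, hx, by simp [wordMap, consCode, he]⟩

/-- The coding map is the pointwise limit of maps that depend on finitely many letters. -/
lemma measurable_coding (h : IsAttractor S s E) : Measurable (S.coding E) := by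
  have := h.nonempty_letters
  obtain ⟨x, hx⟩ := h.nonempty
  refine measurable_of_tendsto_metrizable
    (f := fun (k : ℕ) ω => S.wordMap k (fun j => ω j) x) (fun k => ?_)
    (tendsto_pi_nhds.2 fun ω => ?_)
  · have h1 : Measurable fun (u : Fin k → Fin N) => S.wordMap k u x := measurable_of_finite _
    exact h1.comp (measurable_pi_iff.2 fun j => measurable_pi_apply _)
  · refine tendsto_iff_dist_tendsto_zero.2 (squeeze_zero (fun _ => dist_nonneg) (fun k => ?_)
      S.tendsto_rMax_pow)
    obtain ⟨a, ha, he⟩ := h.coding_mem ω k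
    rw [← he]
    exact h.dist_wordMap_le _ hx ha

/-! ### The natural measure -/

lemma isProbabilityMeasure_letterMeasure (h : IsAttractor S s E) :
    IsProbabilityMeasure (S.letterMeasure s) := by
  refine ⟨?_⟩
  simp only [letterMeasure, Measure.coe_finsetSum, Finset.sum_apply, Measure.smul_apply,
    measure_univ, smul_eq_mul, mul_one]
  rw [← ENNReal.ofReal_sum_of_nonneg fun i _ => (S.ratio_rpow_pos s i).le, h.sum_rpow,
    ENNReal.ofReal_one]

/-- The product measure on codes is the mixture of its images under the maps `ω ↦ i ω`. -/
lemma infinitePi_letterMeasure_eq (h : IsAttractor S s E) :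
    Measure.infinitePi (fun _ : ℕ => S.letterMeasure s) = ∑ i, ENNReal.ofReal (S.r i ^ s) •
      (Measure.infinitePi (fun _ : ℕ => S.letterMeasure s)).map (consCode i) := by
  have := h.isProbabilityMeasure_letterMeasure
  classical
  refine (Measure.eq_infinitePi (fun _ : ℕ => S.letterMeasure s) fun I t ht => ?_).symm
  -- Boxes over `I` are boxes over an initial segment of `ℕ`.
  obtain ⟨m, hm⟩ : ∃ m, I ⊆ Finset.range (m + 1) := by
    obtain ⟨m, hm⟩ := I.bddAbove
    exact ⟨m, fun j hj => Finset.mem_range.2 (Nat.lt_succ_of_le (hm hj))⟩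
  set t' : ℕ → Set (Fin N) := fun j => if j ∈ I then t j else Set.univ with ht'
  have hbox : Set.pi (I : Set ℕ) t = Set.pi (Finset.range (m + 1) : Set ℕ) t' := by
    ext ω
    simp only [Set.mem_pi, Finset.mem_coe, ht']
    refine ⟨fun H j _ => ?_, fun H j hj => by simpa [hj] using H j (hm hj)⟩
    split_ifs with hj
    exacts [H j hj, trivial]
  have hprod : ∏ j ∈ I, S.letterMeasure s (t j) =
      ∏ j ∈ Finset.range (m + 1), S.letterMeasure s (t' j) := by
    rw [← Finset.prod_subset hm fun j _ hj => by simp [ht', hj]]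
    exact Finset.prod_congr rfl fun j hj => by simp [ht', hj]
  have hmeas : MeasurableSet (Set.pi (Finset.range (m + 1) : Set ℕ) t') :=
    MeasurableSet.pi (Finset.countable_toSet _) fun _ _ => (Set.toFinite _).measurableSet
  have hpre : ∀ i, consCode i ⁻¹' Set.pi (Finset.range (m + 1) : Set ℕ) t' =
      if i ∈ t' 0 then Set.pi (Finset.range m : Set ℕ) (fun j => t' (j + 1)) else ∅ := by
    intro i
    ext ω
    split_ifs with hi
    · refine ⟨fun H j hj => H (j + 1) ?_, fun H j hj => ?_⟩
      · simpa using hj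
      · cases j with
        | zero => exact hi
        | succ j => exact H j (by simpa using hj)
    · exact ⟨fun H => hi (H 0 (by simp)), fun H => H.elim⟩
  rw [hprod, hbox, Finset.prod_range_succ']
  simp only [Measure.coe_finsetSum, Finset.sum_apply, Measure.smul_apply, smul_eq_mul,
    Measure.map_apply (measurable_consCode _) hmeas, hpre]
  have hletter : S.letterMeasure s (t' 0) =
      ∑ i, ENNReal.ofReal (S.r i ^ s) * (t' 0).indicator 1 i := by
    simp [letterMeasure]
  rw [hletter, Finset.mul_sum]
  refine Finset.sum_congr rfl fun i _ => ?_
  split_ifs with hi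
  · rw [Measure.infinitePi_pi _ fun _ _ => (Set.toFinite _).measurableSet]
    simp [hi, mul_comm]
  · simp [hi]

end IsAttractor

/-- `μ` is a probability measure on `E` with `μ = ∑ i, r i ^ s • (f i)_* μ`. -/
structure IsSelfSimilarMeasure (S : SimilitudeSystem n N) (s : ℝ)
    (E : Set (EuclideanSpace ℝ (Fin n))) (μ : Measure (EuclideanSpace ℝ (Fin n))) : Prop where
  measure_univ : μ Set.univ = 1
  measure_compl : μ Eᶜ = 0
  apply_eq : ∀ T, MeasurableSet T → μ T = ∑ i, ENNReal.ofReal (S.r i ^ s) * μ (S.f i ⁻¹' T)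

variable {S : SimilitudeSystem n N} {s : ℝ} {E : Set (EuclideanSpace ℝ (Fin n))}
  {x y : EuclideanSpace ℝ (Fin n)} {μ : Measure (EuclideanSpace ℝ (Fin n))}

lemma IsAttractor.isSelfSimilarMeasure_naturalMeasure (h : IsAttractor S s E) :
    IsSelfSimilarMeasure S s E (S.naturalMeasure s E) := by
  have := h.isProbabilityMeasure_letterMeasure
  have hm := h.measurable_coding
  refine ⟨?_, ?_, fun T hT => ?_⟩
  · rw [naturalMeasure, Measure.map_apply hm MeasurableSet.univ, Set.preimage_univ]
    exact MeasureTheory.measure_univ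
  · rw [naturalMeasure, Measure.map_apply hm h.isCompact.measurableSet.compl]
    refine measure_mono_null (fun ω hω => hω (h.coding_mem_self ω)) measure_empty
  · simp only [naturalMeasure, Measure.map_apply hm hT,
      Measure.map_apply hm (S.measurable_f _ hT)]
    conv_lhs => rw [h.infinitePi_letterMeasure_eq]
    simp only [Measure.coe_finsetSum, Finset.sum_apply, Measure.smul_apply, smul_eq_mul,
      Measure.map_apply (measurable_consCode _) (hm hT)]
    refine Finset.sum_congr rfl fun i _ => ?_
    congr 2
    ext ω
    simp [h.coding_consCode]

/-- Different pieces `f i '' E` of `E` have distance at least `c`. -/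
def Separated (S : SimilitudeSystem n N) (E : Set (EuclideanSpace ℝ (Fin n))) (c : ℝ) : Prop :=
  ∀ i j, i ≠ j → ∀ x ∈ E, ∀ y ∈ E, c ≤ dist (S.f i x) (S.f j y)

namespace IsSelfSimilarMeasure

lemma isProbabilityMeasure (hμ : IsSelfSimilarMeasure S s E μ) : IsProbabilityMeasure μ :=
  ⟨hμ.measure_univ⟩

lemma ae_mem (hμ : IsSelfSimilarMeasure S s E μ) : ∀ᵐ x ∂μ, x ∈ E := hμ.measure_compl

lemma measure_le (hμ : IsSelfSimilarMeasure S s E μ) {A B : Set (EuclideanSpace ℝ (Fin n))}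
    (hAB : A ∩ E ⊆ B) : μ A ≤ μ B := by
  refine measure_mono_ae ?_
  filter_upwards [hμ.ae_mem] with x hx hxA using hAB ⟨hxA, hx⟩

lemma apply_eq_sum_word (hμ : IsSelfSimilarMeasure S s E μ) (k : ℕ)
    {T : Set (EuclideanSpace ℝ (Fin n))} (hT : MeasurableSet T) :
    μ T = ∑ u : Fin k → Fin N, ENNReal.ofReal (S.wordRatio u ^ s) * μ (S.wordMap k u ⁻¹' T) := by
  induction k generalizing T with
  | zero =>
    have : S.wordMap 0 default ⁻¹' T = T := rfl
    simp [wordRatio, this]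
  | succ k ih =>
    rw [hμ.apply_eq T hT, ← (Fin.consEquiv fun _ : Fin (k + 1) => Fin N).sum_comp,
      Fintype.sum_prod_type]
    refine Finset.sum_congr rfl fun i _ => ?_
    rw [ih (S.measurable_f i hT), Finset.mul_sum]
    refine Finset.sum_congr rfl fun u _ => ?_
    rw [← mul_assoc, ← ENNReal.ofReal_mul (Real.rpow_nonneg (S.r_pos i).le s),
      ← Real.mul_rpow (S.r_pos i).le (S.wordRatio_pos u).le, ← S.wordRatio_cons]
    rfl

lemma sum_wordRatio (hμ : IsSelfSimilarMeasure S s E μ) (k : ℕ) :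
    ∑ u : Fin k → Fin N, ENNReal.ofReal (S.wordRatio u ^ s) = 1 := by
  have h := hμ.apply_eq_sum_word k MeasurableSet.univ
  simpa [hμ.measure_univ] using h.symm

/-- The self-similarity of `μ` on balls that meet only one of the pieces `f i '' E`. -/
lemma measure_closedBall_f (hμ : IsSelfSimilarMeasure S s E μ) {c : ℝ} (hc : S.Separated E c)
    (i : Fin N) (hx : x ∈ E) {t : ℝ} (ht : S.r i * t < c) :
    μ (Metric.closedBall (S.f i x) (S.r i * t)) =
      ENNReal.ofReal (S.r i ^ s) * μ (Metric.closedBall x t) := by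
  rw [hμ.apply_eq _ measurableSet_closedBall, Finset.sum_eq_single i]
  · congr 2
    ext y
    simp [S.dist_eq, S.r_pos i]
  · intro j _ hj
    have h0 : μ (S.f j ⁻¹' Metric.closedBall (S.f i x) (S.r i * t)) ≤ μ ∅ := by
      refine hμ.measure_le fun y hy => ?_
      have h1 : dist (S.f j y) (S.f i x) ≤ S.r i * t := hy.1
      linarith [hc j i hj y hy.2 x hx]
    rw [measure_empty, nonpos_iff_eq_zero] at h0
    rw [h0, mul_zero]
  · simp

lemma measure_closedBall_wordMap (hμ : IsSelfSimilarMeasure S s E μ) (h : IsAttractor S s E)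
    {c : ℝ} (hc : S.Separated E c) {k : ℕ} (u : Fin k → Fin N) (hx : x ∈ E) {t : ℝ} (ht : t < c)
    (ht0 : 0 ≤ t) :
    μ (Metric.closedBall (S.wordMap k u x) (S.wordRatio u * t)) =
      ENNReal.ofReal (S.wordRatio u ^ s) * μ (Metric.closedBall x t) := by
  induction k with
  | zero => simp [wordMap, wordRatio]
  | succ k ih =>
    obtain ⟨i, v, rfl⟩ : ∃ i v, u = Fin.cons i v := ⟨u 0, Fin.tail u, (Fin.cons_self_tail u).symm⟩
    have hlt : S.r i * (S.wordRatio v * t) < c := by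
      have h1 : S.r i * S.wordRatio v ≤ 1 := by
        rw [← S.wordRatio_cons]
        exact Finset.prod_le_one (fun _ _ => (S.r_pos _).le) fun _ _ => (S.r_lt_one _).le
      nlinarith
    rw [S.wordMap_cons, S.wordRatio_cons, mul_assoc, hμ.measure_closedBall_f hc i
      (h.wordMap_mem v hx) hlt, ih, ← mul_assoc,
      ← ENNReal.ofReal_mul (Real.rpow_nonneg (S.r_pos i).le s),
      ← Real.mul_rpow (S.r_pos i).le (S.wordRatio_pos v).le]

lemma le_measure_closedBall (hμ : IsSelfSimilarMeasure S s E μ) (h : IsAttractor S s E)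
    {k : ℕ} {t : ℝ} (hk : S.rMax ^ k ≤ t) (hx : x ∈ E) :
    ENNReal.ofReal ((S.rMin ^ k) ^ s) ≤ μ (Metric.closedBall x t) := by
  have := h.nonempty_letters
  obtain ⟨u, z, hz, rfl⟩ := h.exists_wordMap_eq k hx
  rw [hμ.apply_eq_sum_word k measurableSet_closedBall]
  refine le_trans ?_ (Finset.single_le_sum (fun _ _ => zero_le) (Finset.mem_univ u))
  have h1 : μ (S.wordMap k u ⁻¹' Metric.closedBall (S.wordMap k u z) t) = 1 := by
    refine le_antisymm (hμ.measure_univ ▸ measure_mono (Set.subset_univ _)) ?_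
    rw [← hμ.measure_univ]
    exact hμ.measure_le fun y hy => (h.dist_wordMap_le u hy.2 hz).trans hk
  rw [h1, mul_one]
  exact ENNReal.ofReal_le_ofReal
    (Real.rpow_le_rpow (by positivity [S.rMin_pos]) (S.rMin_pow_le_wordRatio u) h.dim_pos.le)

lemma measure_closedBall_pos (hμ : IsSelfSimilarMeasure S s E μ) (h : IsAttractor S s E)
    {t : ℝ} (ht : 0 < t) (hx : x ∈ E) : 0 < μ (Metric.closedBall x t) := by
  have := h.nonempty_letters
  obtain ⟨k, hk⟩ := (S.tendsto_rMax_pow.eventually_le_const ht).exists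
  refine lt_of_lt_of_le ?_ (hμ.le_measure_closedBall h hk hx)
  exact ENNReal.ofReal_pos.2 (Real.rpow_pos_of_pos (pow_pos S.rMin_pos k) s)

/-- Every finite word `u` occurs in almost every code at arbitrarily late places. The set `G m` of
the points with no occurrence after at least `m` letters satisfies `μ (G (m + 1)) ≤ μ (G m)` and
`μ (G 0) ≤ (1 - r_u ^ s) μ (G 0)`. -/
lemma ae_exists_wordMap (hμ : IsSelfSimilarMeasure S s E μ) (h : IsAttractor S s E)
    {k : ℕ} (u : Fin k → Fin N) (m : ℕ) :
    ∀ᵐ y ∂μ, ∃ l, m ≤ l ∧ ∃ v : Fin l → Fin N, ∃ z ∈ E,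
      S.wordMap l v (S.wordMap k u z) = y := by
  have := hμ.isProbabilityMeasure
  set G : ℕ → Set (EuclideanSpace ℝ (Fin n)) := fun m =>
    E \ ⋃ (l : ℕ) (_ : m ≤ l) (v : Fin l → Fin N), (S.wordMap l v ∘ S.wordMap k u) '' E with hG
  have hmem : ∀ m y, y ∈ G m ↔ y ∈ E ∧ ∀ l, m ≤ l → ∀ (v : Fin l → Fin N), ∀ z ∈ E,
      S.wordMap l v (S.wordMap k u z) ≠ y := by
    intro m y
    simp [hG]
  have hmeas : ∀ m, MeasurableSet (G m) := by
    refine fun m => h.isCompact.measurableSet.diff (MeasurableSet.iUnion fun l =>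
      MeasurableSet.iUnion fun _ => MeasurableSet.iUnion fun v => IsCompact.measurableSet ?_)
    exact h.isCompact.image ((S.continuous_wordMap v).comp (S.continuous_wordMap u))
  have hf : ∀ m i, S.f i ⁻¹' G (m + 1) ∩ E ⊆ G m := by
    rintro m i y ⟨hy, hyE⟩
    refine (hmem m y).2 ⟨hyE, fun l hl v z hz hzy => ?_⟩
    refine ((hmem _ _).1 hy).2 (l + 1) (by omega) (Fin.cons i v) z hz ?_
    rw [S.wordMap_cons, hzy]
  have hanti : ∀ m, G m ⊆ G (m + 1) := fun m y hy =>
    (hmem _ _).2 ⟨((hmem _ _).1 hy).1, fun l hl => ((hmem _ _).1 hy).2 l (by omega)⟩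
  have hw : ∀ l (v : Fin l → Fin N), S.wordMap l v ⁻¹' G 0 ∩ E ⊆ G 0 := by
    intro l
    induction l with
    | zero => exact fun v y hy => hy.1
    | succ l ih =>
      rintro v y ⟨hy, hyE⟩
      exact ih (fun j => v j.succ) ⟨hf 0 (v 0) ⟨hanti 0 hy, h.wordMap_mem _ hyE⟩, hyE⟩
  have h0 : μ (G 0) = 0 := by
    have hu : μ (S.wordMap k u ⁻¹' G 0) = 0 := by
      refine nonpos_iff_eq_zero.1 ((hμ.measure_le (B := ∅) ?_).trans measure_empty.le)
      rintro y ⟨hy, hyE⟩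
      exact ((hmem _ _).1 hy).2 0 le_rfl Fin.elim0 y hyE rfl
    have h1 := hμ.apply_eq_sum_word k (hmeas 0)
    rw [← Finset.add_sum_erase _ _ (Finset.mem_univ u), hu, mul_zero, zero_add] at h1
    have h2 : ENNReal.ofReal (S.wordRatio u ^ s) * μ (G 0) + μ (G 0) ≤ 0 + μ (G 0) := by
      calc ENNReal.ofReal (S.wordRatio u ^ s) * μ (G 0) + μ (G 0)
          ≤ ENNReal.ofReal (S.wordRatio u ^ s) * μ (G 0) + ∑ v ∈ Finset.univ.erase u,
              ENNReal.ofReal (S.wordRatio v ^ s) * μ (G 0) := by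
            exact add_le_add le_rfl (h1.le.trans (Finset.sum_le_sum fun v _ =>
              mul_le_mul' le_rfl (hμ.measure_le (hw k v))))
        _ = ∑ v : Fin k → Fin N, ENNReal.ofReal (S.wordRatio v ^ s) * μ (G 0) :=
            Finset.add_sum_erase _ (fun v => ENNReal.ofReal (S.wordRatio v ^ s) * μ (G 0))
              (Finset.mem_univ u)
        _ = 0 + μ (G 0) := by rw [← Finset.sum_mul, hμ.sum_wordRatio, one_mul, zero_add]
    have h3 := nonpos_iff_eq_zero.1 ((ENNReal.add_le_add_iff_right (measure_ne_top μ _)).1 h2)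
    refine (mul_eq_zero.1 h3).resolve_left (ENNReal.ofReal_pos.2 ?_).ne'
    exact Real.rpow_pos_of_pos (S.wordRatio_pos u) s
  have hall : μ (G m) = 0 := by
    induction m with
    | zero => exact h0
    | succ m ih =>
      rw [hμ.apply_eq _ (hmeas _)]
      refine Finset.sum_eq_zero fun i _ => ?_
      rw [nonpos_iff_eq_zero.1 ((hμ.measure_le (hf m i)).trans ih.le), mul_zero]
  filter_upwards [hμ.ae_mem, measure_eq_zero_iff_ae_notMem.1 hall] with y hyE hy
  by_contra! hcon
  exact hy ((hmem m y).2 ⟨hyE, hcon⟩)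

/-! ### The density formula for the packing measure of `E` -/

variable {K : ℝ≥0∞} {c d : ℝ}

lemma ofReal_mul_rpow (S : SimilitudeSystem n N) (s : ℝ) (i : Fin N) (hd : 0 ≤ d) :
    ENNReal.ofReal ((2 * (S.r i * d)) ^ s) =
      ENNReal.ofReal (S.r i ^ s) * ENNReal.ofReal ((2 * d) ^ s) := by
  rw [← ENNReal.ofReal_mul (Real.rpow_nonneg (S.r_pos i).le s),
    ← Real.mul_rpow (S.r_pos i).le (by positivity)]
  congr 2
  ring

/-- A ball of radius less than `c` that violates `|B| ^ s ≤ K μ(B)` can be blown up to another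
one. -/
lemma exists_blowUp (hμ : IsSelfSimilarMeasure S s E μ) (h : IsAttractor S s E)
    (hc : S.Separated E c) (hx : x ∈ E) (hd : 0 < d) (hdc : d < c)
    (hK : K * μ (Metric.closedBall x d) < ENNReal.ofReal ((2 * d) ^ s)) :
    ∃ i, ∃ y ∈ E, K * μ (Metric.closedBall y (d / S.r i)) <
      ENNReal.ofReal ((2 * (d / S.r i)) ^ s) := by
  obtain ⟨i, y, hy, rfl⟩ := h.exists_f_eq hx
  refine ⟨i, y, hy, ?_⟩
  have hr := S.r_pos i
  have hdr : d = S.r i * (d / S.r i) := (mul_div_cancel₀ d hr.ne').symm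
  rw [hdr, hμ.measure_closedBall_f hc i hy (by rwa [← hdr]),
    ofReal_mul_rpow S s i (by positivity), mul_left_comm] at hK
  exact lt_of_mul_lt_mul_left' hK

lemma exists_large_ball (hμ : IsSelfSimilarMeasure S s E μ) (h : IsAttractor S s E)
    (hc : S.Separated E c) (hc0 : 0 < c) (hx : x ∈ E) (hd : 0 < d) (hdc : d < c / S.rMin)
    (hK : K * μ (Metric.closedBall x d) < ENNReal.ofReal ((2 * d) ^ s)) :
    ∃ y ∈ E, ∃ t, c ≤ t ∧ t < c / S.rMin ∧
      K * μ (Metric.closedBall y t) < ENNReal.ofReal ((2 * t) ^ s) := by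
  have := h.nonempty_letters
  have hlim : Tendsto (fun m : ℕ => c * S.rMax ^ m) atTop (𝓝 0) := by
    simpa using S.tendsto_rMax_pow.const_mul c
  obtain ⟨m, hm⟩ := (hlim.eventually_le_const hd).exists
  induction m generalizing x d with
  | zero => exact ⟨x, hx, d, by simpa using hm, hdc, hK⟩
  | succ m ih =>
    rcases le_or_gt c d with hcd | hcd
    · exact ⟨x, hx, d, hcd, hdc, hK⟩
    · obtain ⟨i, y, hy, hy'⟩ := hμ.exists_blowUp h hc hx hd hcd hK
      have hr := S.r_pos i
      refine ih hy (div_pos hd hr) ?_ hy' ?_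
      · calc d / S.r i < c / S.r i := by gcongr
          _ ≤ c / S.rMin := div_le_div_of_nonneg_left hc0.le S.rMin_pos (S.rMin_le i)
      · rw [le_div_iff₀ hr]
        calc c * S.rMax ^ m * S.r i ≤ c * S.rMax ^ m * S.rMax :=
              mul_le_mul_of_nonneg_left (S.le_rMax i)
                (mul_nonneg hc0.le (pow_nonneg S.rMax_pos.le m))
          _ ≤ d := by rw [mul_assoc, ← pow_succ]; exact hm

/-- If `K < P^s(E)`, some ball with centre in `E` and radius in `[c, c / r_min)` violates
`|B| ^ s ≤ K μ(B)`. -/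
lemma exists_ball_of_lt_packingMeasure (hμ : IsSelfSimilarMeasure S s E μ)
    (h : IsAttractor S s E) (hc : S.Separated E c) (hc0 : 0 < c) (hK : K < packingMeasure s E) :
    ∃ y ∈ E, ∃ t, c ≤ t ∧ t < c / S.rMin ∧
      K * μ (Metric.closedBall y t) < ENNReal.ofReal ((2 * t) ^ s) := by
  have := h.nonempty_letters
  by_contra! hcon
  refine hK.not_ge ?_
  have hle := packingMeasure_le_of_forall_le (s := s) (E := E) (μ := μ) (κ := K) hc0
    fun x hx d hd hdc => ?_
  · rwa [hμ.measure_univ, mul_one] at hle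
  · by_contra! hlt
    have hcr : c ≤ c / S.rMin := (le_div_iff₀ S.rMin_pos).2 (by nlinarith [S.rMin_lt_one])
    obtain ⟨y, hy, t, h1, h2, h3⟩ := hμ.exists_large_ball h hc hc0 hx hd (by linarith) hlt
    exact (hcon y hy t h1 h2).not_gt h3

lemma packingMeasure_ne_top (hμ : IsSelfSimilarMeasure S s E μ) (h : IsAttractor S s E)
    (hc : S.Separated E c) (hc0 : 0 < c) : packingMeasure s E ≠ ∞ := by
  have := h.nonempty_letters
  obtain ⟨k, hk⟩ := (S.tendsto_rMax_pow.eventually_le_const hc0).exists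
  set b := ENNReal.ofReal ((S.rMin ^ k) ^ s)
  have hb : b ≠ 0 := (ENNReal.ofReal_pos.2 (Real.rpow_pos_of_pos (pow_pos S.rMin_pos k) s)).ne'
  have hfin : ENNReal.ofReal ((2 * (c / S.rMin)) ^ s) / b < ∞ :=
    ENNReal.div_lt_top ENNReal.ofReal_ne_top hb
  refine ne_top_of_le_ne_top hfin.ne (not_lt.1 fun hlt => ?_)
  obtain ⟨y, hy, t, h1, h2, h3⟩ := hμ.exists_ball_of_lt_packingMeasure h hc hc0 hlt
  refine h3.not_ge ?_
  calc ENNReal.ofReal ((2 * t) ^ s) ≤ ENNReal.ofReal ((2 * (c / S.rMin)) ^ s) :=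
        ENNReal.ofReal_le_ofReal
          (Real.rpow_le_rpow (by linarith) (by linarith) h.dim_pos.le)
    _ = ENNReal.ofReal ((2 * (c / S.rMin)) ^ s) / b * b :=
        (ENNReal.div_mul_cancel hb ENNReal.ofReal_ne_top).symm
    _ ≤ _ := by
        gcongr
        exact hμ.le_measure_closedBall h (hk.trans h1) hy

/-- Copies of a ball centred at `x` occur, at arbitrarily small scales, around almost every point
of `E`. -/
lemma rpow_le_packingMeasure_mul_of_lt (hμ : IsSelfSimilarMeasure S s E μ)
    (h : IsAttractor S s E) (hc : S.Separated E c) (hx : x ∈ E) {t : ℝ} (ht : 0 < t) (htd : t < d)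
    (hdc : d < c) :
    ENNReal.ofReal ((2 * t) ^ s) ≤ packingMeasure s E * μ (Metric.closedBall x d) := by
  have := h.nonempty_letters
  have := hμ.isProbabilityMeasure
  have hβ := (hμ.measure_closedBall_pos h (ht.trans htd) hx).ne'
  rw [← ENNReal.div_le_iff hβ (measure_ne_top μ _)]
  set β := μ (Metric.closedBall x d) with hβdef
  obtain ⟨k, hk⟩ := (S.tendsto_rMax_pow.eventually_le_const (sub_pos.2 htd)).exists
  obtain ⟨u, x, hx', rfl⟩ := h.exists_wordMap_eq k hx
  set A := {y | y ∈ E ∧ ∀ m : ℕ, ∃ l, m ≤ l ∧ ∃ v : Fin l → Fin N, ∃ z ∈ E,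
      S.wordMap l v (S.wordMap k u z) = y} with hA
  have hA1 : μ A = 1 := by
    rw [← hμ.measure_univ]
    refine measure_congr (eventuallyEq_univ.2 ?_)
    filter_upwards [hμ.ae_mem, ae_all_iff.2 (hμ.ae_exists_wordMap h u)] with y h1 h2
      using ⟨h1, h2⟩
  rw [← mul_one (_ / _), ← hA1]
  refine le_packingMeasure_of_forall_exists (fun y hy => hy.1) fun y hy δ hδ => ?_
  obtain ⟨m, hm⟩ := (S.tendsto_rMax_pow.eventually_lt_const (div_pos hδ ht)).exists
  obtain ⟨l, hl, v, z, hz, rfl⟩ := hy.2 m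
  have hr := S.wordRatio_pos v
  refine ⟨S.wordRatio v * t, mul_pos hr ht, ?_, ?_⟩
  · rw [← lt_div_iff₀ ht]
    exact ((S.wordRatio_le v).trans
      (pow_le_pow_of_le_one S.rMax_pos.le S.rMax_lt_one.le hl)).trans_lt hm
  · rw [hμ.measure_closedBall_wordMap h hc v (h.wordMap_mem u hz) (htd.trans hdc) ht.le]
    have hball : μ (Metric.closedBall (S.wordMap k u z) t) ≤ β := by
      refine measure_mono (Metric.closedBall_subset_closedBall' ?_)
      linarith [h.dist_wordMap_le u hz hx']
    calc ENNReal.ofReal ((2 * t) ^ s) / β * (ENNReal.ofReal (S.wordRatio v ^ s) *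
          μ (Metric.closedBall (S.wordMap k u z) t))
        ≤ ENNReal.ofReal ((2 * t) ^ s) / β * (ENNReal.ofReal (S.wordRatio v ^ s) * β) := by
          gcongr
      _ = ENNReal.ofReal (S.wordRatio v ^ s) * (ENNReal.ofReal ((2 * t) ^ s) / β * β) := by ring
      _ = ENNReal.ofReal (S.wordRatio v ^ s) * ENNReal.ofReal ((2 * t) ^ s) := by
          rw [ENNReal.div_mul_cancel hβ (measure_ne_top μ _)]
      _ = ENNReal.ofReal ((2 * (S.wordRatio v * t)) ^ s) := by
          rw [← ENNReal.ofReal_mul (Real.rpow_nonneg hr.le s),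
            ← Real.mul_rpow hr.le (by positivity), mul_left_comm]

/-- The density bound `|B| ^ s ≤ P^s(E) μ(B)` for balls with centre in `E` and radius at most
`c / r_min`. -/
lemma rpow_le_packingMeasure_mul (hμ : IsSelfSimilarMeasure S s E μ)
    (h : IsAttractor S s E) (hc : S.Separated E c) (hx : x ∈ E) (hd : 0 < d)
    (hdc : d ≤ c / S.rMin) :
    ENNReal.ofReal ((2 * d) ^ s) ≤ packingMeasure s E * μ (Metric.closedBall x d) := by
  have := h.nonempty_letters
  obtain ⟨i, hi⟩ := S.exists_eq_rMin
  have hr := S.r_pos i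
  rw [← hi, le_div_iff₀ hr, mul_comm] at hdc
  have key : ∀ t, 0 < t → t < d →
      ENNReal.ofReal ((2 * t) ^ s) ≤ packingMeasure s E * μ (Metric.closedBall x d) := by
    intro t ht htd
    obtain ⟨e, hte, hed⟩ := exists_between htd
    have hec : S.r i * e < c := (mul_lt_mul_of_pos_left hed hr).trans_le hdc
    have h1 := hμ.rpow_le_packingMeasure_mul_of_lt h hc (h.f_mem i hx) (mul_pos hr ht)
      (mul_lt_mul_of_pos_left hte hr) hec
    rw [hμ.measure_closedBall_f hc i hx hec, ofReal_mul_rpow S s i ht.le, mul_left_comm,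
      ENNReal.mul_le_mul_iff_right (ENNReal.ofReal_pos.2 (S.ratio_rpow_pos s i)).ne'
        ENNReal.ofReal_ne_top] at h1
    refine h1.trans ?_
    gcongr
  have hcont : Tendsto (fun t : ℝ => ENNReal.ofReal ((2 * t) ^ s)) (𝓝[<] d)
      (𝓝 (ENNReal.ofReal ((2 * d) ^ s))) := by
    refine ENNReal.tendsto_ofReal ?_
    have h2 : Continuous fun t : ℝ => (2 * t) ^ s :=
      (continuous_const.mul continuous_id).rpow_const fun _ => Or.inr h.dim_pos.le
    exact h2.continuousAt.tendsto.mono_left nhdsWithin_le_nhds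
  refine le_of_tendsto hcont ?_
  filter_upwards [Ioo_mem_nhdsLT hd] with t ht using key t ht.1 ht.2

end IsSelfSimilarMeasure

variable {K : ℝ≥0∞} {c d t : ℝ} {k : ℕ}

/-! ### The discrete measures -/

lemma discreteMeasure_apply (S : SimilitudeSystem n N) (s : ℝ) (k : ℕ)
    (T : Set (EuclideanSpace ℝ (Fin n))) :
    S.discreteMeasure s k T =
      ∑ u : Fin k → Fin N, ENNReal.ofReal (S.wordRatio u ^ s) * T.indicator 1 (S.wordPt k u) := by
  simp [discreteMeasure]

lemma discreteMeasure_mono (hk : 1 ≤ k) {A B : Set (EuclideanSpace ℝ (Fin n))}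
    (hAB : A ∩ S.iterates k ⊆ B) : S.discreteMeasure s k A ≤ S.discreteMeasure s k B := by
  simp only [discreteMeasure_apply]
  refine Finset.sum_le_sum fun u _ => mul_le_mul' le_rfl ?_
  by_cases hu : S.wordPt k u ∈ A
  · have hB := hAB ⟨hu, S.wordPt_mem_iterates hk u⟩
    rw [Set.indicator_of_mem hu, Set.indicator_of_mem hB]
  · rw [Set.indicator_of_notMem hu]
    exact zero_le

lemma discreteMeasure_pos (hk : 1 ≤ k) {A : Set (EuclideanSpace ℝ (Fin n))}
    (hx : x ∈ S.iterates k) (hxA : x ∈ A) : 0 < S.discreteMeasure s k A := by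
  obtain ⟨k, rfl⟩ := Nat.exists_eq_add_of_le' hk
  rw [S.iterates_eq_range_wordPt] at hx
  obtain ⟨u, rfl⟩ := hx
  rw [discreteMeasure_apply]
  refine lt_of_lt_of_le ?_ (Finset.single_le_sum (fun _ _ => zero_le) (Finset.mem_univ u))
  rw [Set.indicator_of_mem hxA, Pi.one_apply, mul_one]
  exact ENNReal.ofReal_pos.2 (Real.rpow_pos_of_pos (S.wordRatio_pos u) s)

lemma discreteMeasure_ne_top (S : SimilitudeSystem n N) (s : ℝ) (k : ℕ)
    (A : Set (EuclideanSpace ℝ (Fin n))) : S.discreteMeasure s k A ≠ ∞ := by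
  rw [discreteMeasure_apply]
  refine ENNReal.sum_ne_top.2 fun u _ => ENNReal.mul_ne_top ENNReal.ofReal_ne_top ?_
  by_cases hu : S.wordPt k u ∈ A <;> simp [hu]

lemma discreteMeasure_succ (hk : 1 ≤ k) (T : Set (EuclideanSpace ℝ (Fin n))) :
    S.discreteMeasure s (k + 1) T =
      ∑ i, ENNReal.ofReal (S.r i ^ s) * S.discreteMeasure s k (S.f i ⁻¹' T) := by
  obtain ⟨k, rfl⟩ := Nat.exists_eq_add_of_le' hk
  simp only [discreteMeasure_apply]
  rw [← (Fin.consEquiv fun _ : Fin (k + 2) => Fin N).sum_comp, Fintype.sum_prod_type]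
  refine Finset.sum_congr rfl fun i _ => ?_
  rw [Finset.mul_sum]
  refine Finset.sum_congr rfl fun u _ => ?_
  rw [← mul_assoc, ← ENNReal.ofReal_mul (Real.rpow_nonneg (S.r_pos i).le s),
    ← Real.mul_rpow (S.r_pos i).le (S.wordRatio_pos u).le, ← S.wordRatio_cons]
  congr 1

/-- The self-similarity of the discrete measures on balls that meet only one of the pieces of
`E`. -/
lemma discreteMeasure_ball_f (h : IsAttractor S s E) (hc : S.Separated E c) (hk : 1 ≤ k)
    (i : Fin N) (hx : x ∈ E) (ht : S.r i * t ≤ c) :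
    S.discreteMeasure s (k + 1) (Metric.ball (S.f i x) (S.r i * t)) =
      ENNReal.ofReal (S.r i ^ s) * S.discreteMeasure s k (Metric.ball x t) := by
  rw [discreteMeasure_succ hk, Finset.sum_eq_single i]
  · congr 2
    ext y
    simp [S.dist_eq, S.r_pos i]
  · intro j _ hj
    have h0 : S.discreteMeasure s k (S.f j ⁻¹' Metric.ball (S.f i x) (S.r i * t)) ≤
        S.discreteMeasure s k ∅ := by
      refine discreteMeasure_mono hk fun y hy => ?_
      have h1 : dist (S.f j y) (S.f i x) < S.r i * t := hy.1
      linarith [hc j i hj y (h.iterates_subset k hy.2) x hx]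
    rw [measure_empty, nonpos_iff_eq_zero] at h0
    rw [h0, mul_zero]
  · simp

namespace IsSelfSimilarMeasure

lemma discreteMeasure_ball_le (hμ : IsSelfSimilarMeasure S s E μ) (h : IsAttractor S s E)
    (hk : 1 ≤ k) (hd : t + S.rMax ^ k ≤ d) :
    S.discreteMeasure s k (Metric.ball x t) ≤ μ (Metric.closedBall x d) := by
  rw [discreteMeasure_apply, hμ.apply_eq_sum_word k measurableSet_closedBall]
  refine Finset.sum_le_sum fun u _ => mul_le_mul' le_rfl ?_
  by_cases hu : S.wordPt k u ∈ Metric.ball x t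
  · rw [Set.indicator_of_mem hu, Pi.one_apply, ← hμ.measure_univ]
    refine hμ.measure_le fun y hy => ?_
    have h1 := h.dist_wordPt_le hk u hy.2
    have h2 := dist_triangle (S.wordMap k u y) (S.wordPt k u) x
    have h3 : dist (S.wordPt k u) x < t := hu
    change dist (S.wordMap k u y) x ≤ d
    linarith
  · rw [Set.indicator_of_notMem hu]
    exact zero_le

lemma measure_closedBall_le (hμ : IsSelfSimilarMeasure S s E μ) (h : IsAttractor S s E)
    (hk : 1 ≤ k) (hd : t + S.rMax ^ k < d) :
    μ (Metric.closedBall x t) ≤ S.discreteMeasure s k (Metric.ball x d) := by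
  rw [discreteMeasure_apply, hμ.apply_eq_sum_word k measurableSet_closedBall]
  refine Finset.sum_le_sum fun u _ => mul_le_mul' le_rfl ?_
  by_cases hu : S.wordPt k u ∈ Metric.ball x d
  · rw [Set.indicator_of_mem hu, Pi.one_apply, ← hμ.measure_univ]
    exact measure_mono (Set.subset_univ _)
  · rw [Set.indicator_of_notMem hu, ← measure_empty (μ := μ)]
    refine hμ.measure_le fun y hy => hu ?_
    have h1 := h.dist_wordPt_le hk u hy.2
    have h2 := dist_triangle (S.wordPt k u) (S.wordMap k u y) x
    have h3 : dist (S.wordMap k u y) x ≤ t := hy.1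
    rw [dist_comm (S.wordPt k u) (S.wordMap k u y)] at h2
    change dist (S.wordPt k u) x < d
    linarith

/-! ### The asymptotic upper bound for the discrete densities -/

lemma eventually_forall_rpow_le (hμ : IsSelfSimilarMeasure S s E μ) (h : IsAttractor S s E)
    (hc : S.Separated E c) (hc0 : 0 < c) (hK : packingMeasure s E < K) :
    ∀ᶠ k in atTop, ∀ x ∈ E, ∀ d ∈ Set.Icc c (c / S.rMin),
      ENNReal.ofReal ((2 * d) ^ s) ≤ K * S.discreteMeasure s k (Metric.ball x d) := by
  have := h.nonempty_letters
  have hP := hμ.packingMeasure_ne_top h hc hc0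
  have hη : Tendsto (fun k : ℕ => c - 2 * S.rMax ^ k) atTop (𝓝 c) := by
    simpa using (S.tendsto_rMax_pow.const_mul 2).const_sub c
  have hlim : Tendsto (fun k : ℕ => ENNReal.ofReal ((c / (c - 2 * S.rMax ^ k)) ^ s) *
      packingMeasure s E) atTop (𝓝 (packingMeasure s E)) := by
    have h1 : Tendsto (fun k : ℕ => (c / (c - 2 * S.rMax ^ k)) ^ s) atTop (𝓝 1) := by
      have h2 := ((tendsto_const_nhds (x := c)).div hη hc0.ne').rpow_const (p := s) (Or.inr h.dim_pos.le)
      rwa [div_self hc0.ne', Real.one_rpow] at h2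
    simpa using ENNReal.Tendsto.mul_const (ENNReal.tendsto_ofReal h1) (Or.inr hP)
  filter_upwards [hlim.eventually_le_const hK, hη.eventually_const_lt hc0, eventually_ge_atTop 1]
    with k h1 h2 hk x hx d hd
  have hηk : 0 < S.rMax ^ k := pow_pos S.rMax_pos k
  set η := S.rMax ^ k
  have hdη : 0 < d - 2 * η := by linarith [hd.1]
  calc ENNReal.ofReal ((2 * d) ^ s)
      ≤ ENNReal.ofReal ((c / (c - 2 * η)) ^ s * (2 * (d - 2 * η)) ^ s) := by
        refine ENNReal.ofReal_le_ofReal ?_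
        rw [← Real.mul_rpow (by positivity) (by positivity)]
        refine Real.rpow_le_rpow (by linarith [hd.1]) ?_ h.dim_pos.le
        rw [div_mul_eq_mul_div, le_div_iff₀ h2]
        nlinarith [mul_le_mul_of_nonneg_left hd.1 hηk.le]
    _ = ENNReal.ofReal ((c / (c - 2 * η)) ^ s) * ENNReal.ofReal ((2 * (d - 2 * η)) ^ s) :=
        ENNReal.ofReal_mul (by positivity)
    _ ≤ ENNReal.ofReal ((c / (c - 2 * η)) ^ s) *
          (packingMeasure s E * μ (Metric.closedBall x (d - 2 * η))) := by
        gcongr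
        exact hμ.rpow_le_packingMeasure_mul h hc hx hdη (by linarith [hd.2])
    _ ≤ K * S.discreteMeasure s k (Metric.ball x d) := by
        rw [← mul_assoc]
        refine mul_le_mul' h1 (hμ.measure_closedBall_le h hk ?_)
        change d - 2 * η + η < d
        linarith

end IsSelfSimilarMeasure

/-! ### The asymptotic lower bound for the discrete densities -/

/-- Enlarging an open ball up to the next point of `A_k` does not change its discrete measure; so
a good ball around a point of `A_k` yields a good pair of `ownPairs c k`, if the next point is not
too far away. -/
lemma eventually_exists_ownPairs {k₀ k₁ : ℕ} (hx : x ∈ S.iterates k₀) (hct : c ≤ t)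
    (hs : 0 ≤ s) (hc0 : 0 < c)
    (hK : ∀ᶠ k in atTop, K * S.discreteMeasure s k (Metric.ball x t) ≤
      ENNReal.ofReal ((2 * t) ^ s))
    (hy : y ∈ S.iterates k₁) (hty : t ≤ dist x y) (hyc : dist x y ≤ c / S.rMin) :
    ∀ᶠ k in atTop, ∃ p ∈ S.ownPairs c k,
      K * S.discreteMeasure s k (Metric.ball p.1 p.2) ≤ ENNReal.ofReal ((2 * p.2) ^ s) := by
  filter_upwards [hK, eventually_ge_atTop k₀, eventually_ge_atTop k₁, eventually_ge_atTop 1]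
    with k hKk hk₀ hk₁ hk
  have hfin : {z ∈ S.iterates k | t ≤ dist x z ∧ dist x z ≤ c / S.rMin}.Finite :=
    (S.finite_iterates k).subset (Set.sep_subset _ _)
  obtain ⟨z, ⟨hz, htz, hzc⟩, hmin⟩ := Set.exists_min_image _ (fun z => dist x z) hfin
    ⟨y, S.monotone_iterates hk₁ hy, hty, hyc⟩
  refine ⟨(x, dist x z), ⟨S.monotone_iterates hk₀ hx, ⟨z, hz, rfl⟩, hct.trans htz, hzc⟩, ?_⟩
  calc K * S.discreteMeasure s k (Metric.ball x (dist x z))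
      ≤ K * S.discreteMeasure s k (Metric.ball x t) := by
        refine mul_le_mul' le_rfl (discreteMeasure_mono hk fun w hw => ?_)
        have h1 : dist w x < dist x z := hw.1
        rw [dist_comm] at h1
        rw [Metric.mem_ball']
        by_contra! h2
        exact (hmin w ⟨hw.2, h2, h1.le.trans hzc⟩).not_gt h1
    _ ≤ ENNReal.ofReal ((2 * t) ^ s) := hKk
    _ ≤ ENNReal.ofReal ((2 * dist x z) ^ s) :=
        ENNReal.ofReal_le_ofReal (Real.rpow_le_rpow (by linarith) (by linarith) hs)

namespace IsSelfSimilarMeasure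

lemma exists_lt_rpow (hs : 0 ≤ s) {a b : ℝ} (hab : a < b) {m : ℝ≥0∞}
    (hm : m < ENNReal.ofReal ((2 * b) ^ s)) :
    ∃ t, a < t ∧ t < b ∧ m < ENNReal.ofReal ((2 * t) ^ s) := by
  have hcont : Continuous fun t : ℝ => ENNReal.ofReal ((2 * t) ^ s) :=
    ENNReal.continuous_ofReal.comp
      ((continuous_const.mul continuous_id).rpow_const fun _ => Or.inr hs)
  have h1 : ∀ᶠ t in 𝓝[<] b, m < ENNReal.ofReal ((2 * t) ^ s) :=
    (hcont.continuousAt.tendsto.mono_left nhdsWithin_le_nhds).eventually_const_lt hm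
  obtain ⟨t, ht, hat, htb⟩ := (h1.and (Ioo_mem_nhdsLT hab)).exists
  exact ⟨t, hat, htb, ht⟩

/-- The radius in `exists_ball_of_lt_packingMeasure` can be taken in the open interval: a ball of
radius `c` may be shrunk slightly and blown up. -/
lemma exists_ball_radius_mem_Ioo (hμ : IsSelfSimilarMeasure S s E μ)
    (h : IsAttractor S s E) (hc : S.Separated E c) (hc0 : 0 < c) (hK : K < packingMeasure s E) :
    ∃ y ∈ E, ∃ t, c < t ∧ t < c / S.rMin ∧
      K * μ (Metric.closedBall y t) < ENNReal.ofReal ((2 * t) ^ s) := by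
  have := h.nonempty_letters
  obtain ⟨y, hy, t, hct, htc, hlt⟩ := hμ.exists_ball_of_lt_packingMeasure h hc hc0 hK
  rcases hct.lt_or_eq with hct | rfl
  · exact ⟨y, hy, t, hct, htc, hlt⟩
  have hmax : S.rMax * c < c := mul_lt_of_lt_one_left hc0 S.rMax_lt_one
  obtain ⟨e, he, hec, hlt'⟩ := exists_lt_rpow h.dim_pos.le hmax hlt
  have he0 : 0 < e := (mul_pos S.rMax_pos hc0).trans he
  obtain ⟨i, z, hz, hz'⟩ := hμ.exists_blowUp h hc hy he0 hec (lt_of_le_of_lt (by gcongr) hlt')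
  refine ⟨z, hz, e / S.r i, ?_, ?_, hz'⟩
  · rw [lt_div_iff₀ (S.r_pos i), mul_comm]
    exact (mul_le_mul_of_nonneg_right (S.le_rMax i) hc0.le).trans_lt he
  · calc e / S.r i < c / S.r i := div_lt_div_of_pos_right hec (S.r_pos i)
      _ ≤ c / S.rMin := div_le_div_of_nonneg_left hc0.le S.rMin_pos (S.rMin_le i)

/-- For `K < P^s(E)` there are a point `x` of some `A_k` and a radius `t` such that `K μ_k(B'(x, t)) ≤ (2 t) ^ s`
for all large `k`. -/
lemma exists_eventually_le (hμ : IsSelfSimilarMeasure S s E μ)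
    (h : IsAttractor S s E) (hc : S.Separated E c) (hc0 : 0 < c) (hK : K < packingMeasure s E) :
    ∃ k₀, ∃ x ∈ S.iterates k₀, ∃ t, c ≤ t ∧ t ≤ c / S.rMin ∧
      ∀ᶠ k in atTop, K * S.discreteMeasure s k (Metric.ball x t) ≤
        ENNReal.ofReal ((2 * t) ^ s) := by
  have := h.nonempty_letters
  obtain ⟨y, hy, d, hcd, hdc, hlt⟩ := hμ.exists_ball_radius_mem_Ioo h hc hc0 hK
  obtain ⟨t, hct, htd, hlt'⟩ := exists_lt_rpow h.dim_pos.le hcd hlt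
  have hε : 0 < (d - t) / 2 := by linarith
  have hev := S.tendsto_rMax_pow.eventually_le_const hε
  obtain ⟨k₀, hk₀, hk₀'⟩ := (hev.and (eventually_ge_atTop 1)).exists
  obtain ⟨x, hx, hxy⟩ := h.exists_mem_iterates hk₀' hy
  refine ⟨k₀, x, hx, t, hct.le, by linarith, ?_⟩
  filter_upwards [hev, eventually_ge_atTop 1] with k hk hk1
  refine le_trans (mul_le_mul' le_rfl ?_) hlt'.le
  refine (hμ.discreteMeasure_ball_le h hk1 (d := (d + t) / 2) (by linarith)).trans
    (measure_mono (Metric.closedBall_subset_closedBall' ?_))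
  rw [dist_comm]
  linarith

/-- For `K < P^s(E)` and all large `k` some pair of `ownPairs c k` has discrete density at
least `K`. -/
lemma eventually_exists_le_rpow (hμ : IsSelfSimilarMeasure S s E μ)
    (h : IsAttractor S s E) (hc : S.Separated E c) (hc0 : 0 < c) (hK : K < packingMeasure s E) :
    ∀ᶠ k in atTop, ∃ p ∈ S.ownPairs c k,
      K * S.discreteMeasure s k (Metric.ball p.1 p.2) ≤ ENNReal.ofReal ((2 * p.2) ^ s) := by
  have := h.nonempty_letters
  have hP := hμ.packingMeasure_ne_top h hc hc0
  obtain ⟨i, hi⟩ := S.exists_eq_rMin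
  have hr := S.r_pos i
  set a := ENNReal.ofReal (S.r i ^ s) with ha
  have ha0 : a ≠ 0 := (ENNReal.ofReal_pos.2 (S.ratio_rpow_pos s i)).ne'
  have haP : a * packingMeasure s E < packingMeasure s E := by
    calc a * packingMeasure s E < 1 * packingMeasure s E := by
          refine ENNReal.mul_lt_mul_left (zero_le.trans_lt hK).ne' hP ?_
          exact ENNReal.ofReal_lt_one.2 (Real.rpow_lt_one hr.le (S.r_lt_one i) h.dim_pos)
      _ = packingMeasure s E := one_mul _
  -- It suffices to treat constants `L` close to `P^s(E)`.
  obtain ⟨L, hL, hLP⟩ := exists_between (max_lt hK haP)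
  suffices H : ∀ᶠ k in atTop, ∃ p ∈ S.ownPairs c k,
      L * S.discreteMeasure s k (Metric.ball p.1 p.2) ≤ ENNReal.ofReal ((2 * p.2) ^ s) by
    filter_upwards [H] with k hk
    obtain ⟨p, hp, hp'⟩ := hk
    exact ⟨p, hp, (mul_le_mul' ((le_max_left _ _).trans hL.le) le_rfl).trans hp'⟩
  obtain ⟨k₀, x, hx, t, hct, htc, hev⟩ := hμ.exists_eventually_le h hc hc0 hLP
  set R := c / S.rMin with hR
  have hRc : S.r i * R = c := by rw [hR, hi]; exact mul_div_cancel₀ c S.rMin_pos.ne'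
  have hcR : c ≤ R := hct.trans htc
  -- If no point of any `A_k` has its distance from `z` in `[b, R]`, then the balls
  -- `B'(z, b)` and `B'(z, R)` contain the same points.
  have hgap : ∀ z b, (∀ k, ∀ y ∈ S.iterates k, b ≤ dist z y → ¬ dist z y ≤ R) →
      ∀ k, 1 ≤ k → S.discreteMeasure s k (Metric.ball z R) ≤
        S.discreteMeasure s k (Metric.ball z b) := by
    intro z b hz k hk
    refine discreteMeasure_mono hk fun w hw => ?_
    have h1 : dist z w < R := Metric.mem_ball'.1 hw.1
    rw [Metric.mem_ball']
    by_contra! h2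
    exact hz k w hw.2 h2 h1.le
  by_cases h1 : ∃ k, ∃ y ∈ S.iterates k, t ≤ dist x y ∧ dist x y ≤ R
  · obtain ⟨k₁, y, hy, hty, hyc⟩ := h1
    exact eventually_exists_ownPairs hx hct h.dim_pos.le hc0 hev hy hty hyc
  push Not at h1
  -- The ball `B'(x, R)` is as good as `B'(x, t)`; its copy has the radius `c`.
  have hx' : S.f i x ∈ S.iterates (k₀ + 1) := S.f_mem_iterates i hx
  have hev' : ∀ᶠ k in atTop, L * S.discreteMeasure s k (Metric.ball (S.f i x) c) ≤
      ENNReal.ofReal ((2 * c) ^ s) := by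
    obtain ⟨m, hm⟩ := eventually_atTop.1 hev
    filter_upwards [eventually_ge_atTop (m + 2)] with k hk
    obtain ⟨k, rfl⟩ := Nat.exists_eq_add_of_le' (show 1 ≤ k by omega)
    nth_rewrite 1 [← hRc]
    rw [discreteMeasure_ball_f h hc (by omega) i (h.iterates_subset k₀ hx) hRc.le, ← hRc,
      ofReal_mul_rpow S s i (hc0.le.trans hcR), mul_left_comm]
    gcongr a * ?_
    calc L * S.discreteMeasure s k (Metric.ball x R)
        ≤ L * S.discreteMeasure s k (Metric.ball x t) := by
          gcongr L * ?_
          exact hgap x t (fun k y hy hty => not_le.2 (h1 k y hy hty)) k (by omega)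
      _ ≤ ENNReal.ofReal ((2 * t) ^ s) := hm k (by omega)
      _ ≤ ENNReal.ofReal ((2 * R) ^ s) :=
          ENNReal.ofReal_le_ofReal (Real.rpow_le_rpow (by linarith) (by linarith) h.dim_pos.le)
  by_cases h2 : ∃ k, ∃ y ∈ S.iterates k, c ≤ dist (S.f i x) y ∧ dist (S.f i x) y ≤ R
  · obtain ⟨k₁, y, hy, hty, hyc⟩ := h2
    exact eventually_exists_ownPairs hx' le_rfl h.dim_pos.le hc0 hev' hy hty hyc
  push Not at h2
  -- Now `B'(f i x, R)` has too large a density.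
  exfalso
  have hLa : packingMeasure s E < L / a := by
    rw [ENNReal.lt_div_iff_mul_lt (Or.inl ha0) (Or.inl ENNReal.ofReal_ne_top), mul_comm]
    exact (le_max_right _ _).trans_lt hL
  obtain ⟨M, hPM, hM⟩ := exists_between hLa
  rw [ENNReal.lt_div_iff_mul_lt (Or.inl ha0) (Or.inl ENNReal.ofReal_ne_top)] at hM
  obtain ⟨k, hk1, hk2, hk, hkk⟩ := (hev'.and ((hμ.eventually_forall_rpow_le h hc hc0 hPM).and
    ((eventually_ge_atTop 1).and (eventually_ge_atTop (k₀ + 1))))).exists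
  have hle : L * S.discreteMeasure s k (Metric.ball (S.f i x) R) ≤
      M * a * S.discreteMeasure s k (Metric.ball (S.f i x) R) := by
    calc L * S.discreteMeasure s k (Metric.ball (S.f i x) R)
        ≤ L * S.discreteMeasure s k (Metric.ball (S.f i x) c) := by
          gcongr L * ?_
          exact hgap _ c (fun k y hy hty => not_le.2 (h2 k y hy hty)) k hk
      _ ≤ ENNReal.ofReal ((2 * c) ^ s) := hk1
      _ = a * ENNReal.ofReal ((2 * R) ^ s) := by
          rw [← hRc, ofReal_mul_rpow S s i (hc0.le.trans hcR)]
      _ ≤ a * (M * S.discreteMeasure s k (Metric.ball (S.f i x) R)) := by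
          gcongr a * ?_
          exact hk2 _ (h.iterates_subset _ hx') R ⟨hcR, le_rfl⟩
      _ = M * a * S.discreteMeasure s k (Metric.ball (S.f i x) R) := by ring
  have hpos : S.discreteMeasure s k (Metric.ball (S.f i x) R) ≠ 0 :=
    (discreteMeasure_pos hk (S.monotone_iterates hkk hx')
      (Metric.mem_ball_self (hc0.trans_le hcR))).ne'
  exact hM.not_ge ((ENNReal.mul_le_mul_iff_left hpos (S.discreteMeasure_ne_top s k _)).1 hle)

end IsSelfSimilarMeasure

/-! ### The maximal discrete density -/

variable {p : EuclideanSpace ℝ (Fin n) × ℝ}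

lemma ownPairs_subset_allPairs (S : SimilitudeSystem n N) (c : ℝ) (k : ℕ) :
    S.ownPairs c k ⊆ S.allPairs c k :=
  fun p hp => ⟨hp.1, Set.mem_iUnion₂.2 ⟨p.1, hp.1, hp.2⟩⟩

lemma mem_Icc_of_mem_allPairs (hp : p ∈ S.allPairs c k) : p.2 ∈ Set.Icc c (c / S.rMin) := by
  obtain ⟨x, -, hx⟩ := Set.mem_iUnion₂.1 hp.2
  exact hx.2

lemma finite_allPairs (S : SimilitudeSystem n N) (c : ℝ) (k : ℕ) : (S.allPairs c k).Finite := by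
  refine (S.finite_iterates k).prod ((S.finite_iterates k).biUnion fun x _ => ?_)
  refine ((S.finite_iterates k).image fun y => dist x y).subset ?_
  rintro _ ⟨⟨y, hy, rfl⟩, -⟩
  exact ⟨y, hy, rfl⟩

lemma discreteMeasure_real_pos (hk : 1 ≤ k) (hc0 : 0 < c) (hp : p ∈ S.allPairs c k) :
    0 < (S.discreteMeasure s k).real (Metric.ball p.1 p.2) :=
  ENNReal.toReal_pos (discreteMeasure_pos hk hp.1
    (Metric.mem_ball_self (hc0.trans_le (mem_Icc_of_mem_allPairs hp).1))).ne'
    (S.discreteMeasure_ne_top s k _)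

lemma le_discreteDensity (hk : 1 ≤ k) (hc0 : 0 < c) (hp : p ∈ S.allPairs c k) {K : ℝ}
    (h : ENNReal.ofReal K * S.discreteMeasure s k (Metric.ball p.1 p.2) ≤
      ENNReal.ofReal ((2 * p.2) ^ s)) : K ≤ S.discreteDensity s k p := by
  have hd : 0 < p.2 := hc0.trans_le (mem_Icc_of_mem_allPairs hp).1
  rcases le_or_gt K 0 with hK | hK
  · exact hK.trans (div_nonneg (Real.rpow_nonneg (by positivity) s) measureReal_nonneg)
  rw [discreteDensity, le_div_iff₀ (discreteMeasure_real_pos hk hc0 hp)]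
  have h1 := ENNReal.toReal_mono ENNReal.ofReal_ne_top h
  rwa [ENNReal.toReal_mul, ENNReal.toReal_ofReal hK.le,
    ENNReal.toReal_ofReal (Real.rpow_nonneg (by positivity) s)] at h1

lemma discreteDensity_le (hk : 1 ≤ k) (hc0 : 0 < c) (hp : p ∈ S.allPairs c k) {K : ℝ}
    (hK : 0 ≤ K) (h : ENNReal.ofReal ((2 * p.2) ^ s) ≤
      ENNReal.ofReal K * S.discreteMeasure s k (Metric.ball p.1 p.2)) :
    S.discreteDensity s k p ≤ K := by
  have hd : 0 < p.2 := hc0.trans_le (mem_Icc_of_mem_allPairs hp).1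
  rw [discreteDensity, div_le_iff₀ (discreteMeasure_real_pos hk hc0 hp)]
  have h1 := ENNReal.toReal_mono
    (ENNReal.mul_ne_top ENNReal.ofReal_ne_top (S.discreteMeasure_ne_top s k _)) h
  rwa [ENNReal.toReal_mul, ENNReal.toReal_ofReal hK,
    ENNReal.toReal_ofReal (Real.rpow_nonneg (by positivity) s)] at h1

lemma isGreatest_maxDensity {Q : Set (EuclideanSpace ℝ (Fin n) × ℝ)} (hfin : Q.Finite)
    (hne : Q.Nonempty) : IsGreatest (S.discreteDensity s k '' Q) (S.maxDensity s k Q) :=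
  ⟨(hne.image _).csSup_mem (hfin.image _), fun _ hx => le_csSup (hfin.image _).bddAbove hx⟩

end SimilitudeSystem

theorem theorem3 {n N : ℕ} (S : SimilitudeSystem n N)
    (s : ℝ) (hs : ∑ i, S.r i ^ s = 1)
    (E : Set (EuclideanSpace ℝ (Fin n))) (hE : IsCompact E) (hfix : E = ⋃ i, S.f i '' E)
    (hdiam : Metric.diam E = 1)
    (hSSC : ∀ i j, i ≠ j → Disjoint (S.f i '' E) (S.f j '' E))
    (kt : ℕ) (hkt : 1 ≤ kt) (hc : 0 < S.cTilde kt)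
    (Q : ℕ → Set (EuclideanSpace ℝ (Fin n) × ℝ))
    (hQ : Q = S.allPairs (S.cTilde kt) ∨ Q = S.ownPairs (S.cTilde kt)) :
    packingMeasure s E ≠ ∞ ∧
    (∀ᶠ k in atTop, IsGreatest (S.discreteDensity s k '' Q k) (S.maxDensity s k (Q k))) ∧
    Tendsto (fun k => S.maxDensity s k (Q k)) atTop (𝓝 (packingMeasure s E).toReal) ∧
    ∀ k, 1 ≤ k → ∀ p ∈ Q k, S.discreteDensity s k p = S.maxDensity s k (Q k) →
      S.discreteMeasure s k (Metric.ball p.1 p.2) =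
        S.naturalMeasure s E (Metric.closedBall p.1 p.2) →
      S.maxDensity s k (Q k) ≤ (packingMeasure s E).toReal := by
  have h : S.IsAttractor s E := ⟨hs, hE, hfix, hdiam⟩
  have hμ := h.isSelfSimilarMeasure_naturalMeasure
  have hsep : S.Separated E (S.cTilde kt) := fun i j hij x hx y hy =>
    h.cTilde_le_dist hkt hij hx hy
  set c := S.cTilde kt
  have hP := hμ.packingMeasure_ne_top h hsep hc
  have hQall : ∀ k, Q k ⊆ S.allPairs c k := by
    rcases hQ with rfl | rfl
    exacts [fun k => subset_rfl, S.ownPairs_subset_allPairs c]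
  have hQown : ∀ k, S.ownPairs c k ⊆ Q k := by
    rcases hQ with rfl | rfl
    exacts [S.ownPairs_subset_allPairs c, fun k => subset_rfl]
  have hP0 : packingMeasure s E ≠ 0 := by
    intro h0
    obtain ⟨x, hx⟩ := h.nonempty
    have := h.nonempty_letters
    have h1 := hμ.rpow_le_packingMeasure_mul h hsep hx hc
      ((le_div_iff₀ S.rMin_pos).2 (mul_le_of_le_one_right hc.le S.rMin_lt_one.le))
    rw [h0, zero_mul, nonpos_iff_eq_zero, ENNReal.ofReal_eq_zero] at h1
    exact h1.not_gt (Real.rpow_pos_of_pos (by positivity) s)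
  have hPpos : 0 < (packingMeasure s E).toReal := ENNReal.toReal_pos hP0 hP
  have hofReal : ∀ K < (packingMeasure s E).toReal, ENNReal.ofReal K < packingMeasure s E :=
    fun K hK => ENNReal.ofReal_toReal hP ▸ (ENNReal.ofReal_lt_ofReal_iff hPpos).2 hK
  have hlow : ∀ K < (packingMeasure s E).toReal,
      ∀ᶠ k in atTop, ∃ p ∈ Q k, K ≤ S.discreteDensity s k p := by
    intro K hK
    filter_upwards [hμ.eventually_exists_le_rpow h hsep hc
      (hofReal K hK), eventually_ge_atTop 1] with k hk hk1
    obtain ⟨p, hp, hp'⟩ := hk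
    exact ⟨p, hQown k hp,
      S.le_discreteDensity hk1 hc (S.ownPairs_subset_allPairs c k hp) hp'⟩
  have hgreat : ∀ᶠ k in atTop,
      IsGreatest (S.discreteDensity s k '' Q k) (S.maxDensity s k (Q k)) := by
    filter_upwards [hlow 0 hPpos] with k hk
    obtain ⟨p, hp, -⟩ := hk
    exact S.isGreatest_maxDensity ((S.finite_allPairs c k).subset (hQall k)) ⟨p, hp⟩
  refine ⟨hP, hgreat, tendsto_order.2 ⟨fun a ha => ?_, fun b hb => ?_⟩, fun k hk p hp hmax heq => ?_⟩
  · obtain ⟨K, haK, hK⟩ := exists_between ha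
    filter_upwards [hlow K hK, hgreat] with k hk hg
    obtain ⟨p, hp, hp'⟩ := hk
    exact haK.trans_le (hp'.trans (hg.2 ⟨p, hp, rfl⟩))
  · obtain ⟨K, hK, hKb⟩ := exists_between hb
    filter_upwards [hμ.eventually_forall_rpow_le h hsep hc
      ((ENNReal.lt_ofReal_iff_toReal_lt hP).2 hK), hgreat, eventually_ge_atTop 1] with k hk hg hk1
    obtain ⟨p, hp, hp'⟩ := hg.1
    rw [← hp']
    refine lt_of_le_of_lt (SimilitudeSystem.discreteDensity_le hk1 hc (hQall k hp)
      (hPpos.trans hK).le ?_) hKb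
    exact hk p.1 (h.iterates_subset k (hQall k hp).1) p.2
      (SimilitudeSystem.mem_Icc_of_mem_allPairs (hQall k hp))
  · rw [← hmax]
    have hIcc := SimilitudeSystem.mem_Icc_of_mem_allPairs (hQall k hp)
    refine SimilitudeSystem.discreteDensity_le hk hc (hQall k hp) hPpos.le ?_
    rw [ENNReal.ofReal_toReal hP, heq]
    exact hμ.rpow_le_packingMeasure_mul h hsep (h.iterates_subset k (hQall k hp).1)
      (hc.trans_le hIcc.1) hIcc.2
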